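/- Let $p\ge 1$ be an integer. On $\mathbb{R}^3$ consider the distribution $\Delta=\mathrm{span}\{f_1,f_2\}$ with $$f_1=\frac{\partial}{\partial x_1},\qquad f_2=(1-x_1)\frac{\partial}{\partial x_2}+x_1^p\,\frac{\partial}{\partial x_3},$$ with the metric $g$ on $\Delta$ that makes $f_1,f_2$ orthonormal. A curve $\eta:[a,b]\to\mathbb{R}^3$ is horizontal if it is absolutely continuous and $\dot\eta=u_1f_1(\eta)+u_2f_2(\eta)$ a.e. for some (unique) control $u\in L^1([a,b];\mathbb{R}^2)$; its length is $J(u)=\|u\|_{L^1}=\int_a^b|u|\,dt$. It is length-minimizing if no horizontal curve with the same end-points is shorter. For $q_0\in\mathbb{R}^3$, the end-point map $F_{q_0}:L^1([a,b];\mathbb{R}^2)\to\mathbb{R}^3$ sends $u$ to the final point of the trajectory with control $u$ starting from $q_0$, and the extended end-point map is $\mathcal{F}=(F_{q_0},J)$, whose differential $d_u\mathcal{F}$ is taken in the sense of directional derivatives. A horizontal curve is an extremal if it satisfies the Pontryagin Maximum Principle for the length, that is, if there are $\lambda_0\le 0$ and an absolutely continuous curve of covectors $\lambda(t)$, with $(\lambda(t),\lambda_0)\neq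 0$, solving the adjoint equation $\dot\lambda=-\lambda\circ D\big(u_1f_1+u_2f_2\big)(\eta)$, such that for a.e. $t$ the control $u(t)$ maximizes $w\mapsto\langle\lambda(t),w_1f_1(\eta(t))+w_2f_2(\eta(t))\rangle+\lambda_0|w|$ over $w\in\mathbb{R}^2$. An extremal with control $u$ and initial point $q_0$ is strictly singular if $d_u\mathcal{F}$ is not surjective and every $(\ell,\ell_0)\in(\mathbb{R}^3)^*\times\mathbb{R}$ that annihilates the image of $d_u\mathcal{F}$ has $\ell_0=0$. A curve on an interval $I$ is locally length-minimizing if every $t\in I$ has a neighbourhood such that the curve is length-minimizing on each compact subinterval of $I$ contained in it. Let $\gamma(t)=(0,t,0)$, $t\in\mathbb{R}$. Then: (i) If $p\ge 2$, then for all $a<b$ the curve $\gamma|_{[a,b]}$ is a strictly singular extremal. (ii) If $p$ is even, then $\gamma$ is locally length-minimizing. More precisely, whenever $0<b-a<\frac{2}{p+1}$, the segment $\gamma|_{[a,b]}$ is length-minimizing, and it is the only length-minimizing curve between its end-points, up to a monotone change of parameter. (iii) If $p=3$, then for all $a<b$ the curve $\gamma|_{[a,b]}$ is not locally length-minimizing,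 and the end-point map $F_{\gamma(a)}:L^1([a,b];\mathbb{R}^2)\to\mathbb{R}^3$ is open at the control $u=(0,1)$ of $\gamma|_{[a,b]}$, i.e. it maps neighbourhoods of $u$ to neighbourhoods of $\gamma(b)$. -/

import Mathlib

open MeasureTheory Set Filter Topology

noncomputable section

namespace SubRiem

/-- The space of controls `L¹([a, b]; ℝᵏ)`, with `ℝᵏ` Euclidean; `‖u‖ = ∫ₐᵇ |u(t)| dt`. -/
abbrev Control (k : ℕ) (a b : ℝ) : Type :=
  Lp (EuclideanSpace ℝ (Fin k)) 1 (volume.restrict (Icc a b))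

/-- A frame of `k` vector fields on `ℝⁿ`, spanning a distribution. -/
abbrev Frame (n k : ℕ) : Type :=
  Fin k → EuclideanSpace ℝ (Fin n) → EuclideanSpace ℝ (Fin n)

/-- `f_w(x) = ∑ᵢ wᵢ fᵢ(x)`. -/
def Frame.comb {n k : ℕ} (f : Frame n k) (w : EuclideanSpace ℝ (Fin k))
    (x : EuclideanSpace ℝ (Fin n)) : EuclideanSpace ℝ (Fin n) :=
  ∑ i, w i • f i x

/-- The restriction of `γ` to `[a, b]` is an admissible (horizontal) curve with control `u`:
it is absolutely continuous and `γ' = ∑ᵢ uᵢ fᵢ(γ)` a.e. on `[a, b]`. Its length, for the metric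
that makes the (linearly independent) fields `fᵢ` orthonormal, is `‖u‖`. -/
structure HasControl {n k : ℕ} (f : Frame n k) {a b : ℝ} (γ : ℝ → EuclideanSpace ℝ (Fin n))
    (u : Control k a b) : Prop where
  ac : AbsolutelyContinuousOnInterval γ a b
  ode : ∀ᵐ t ∂(volume.restrict (Icc a b)), HasDerivAt γ (f.comb (u t) (γ t)) t

open Classical in
/-- The end-point map `F_{q₀} : L¹([a, b]; ℝᵏ) → ℝⁿ`, `u ↦ γ(b)`, where `γ` is the trajectory with
control `u` and `γ(a) = q₀`. (The default value `q₀` is used only if there is no trajectory on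
all of `[a, b]`.) -/
def endpointMap {n k : ℕ} (f : Frame n k) (a b : ℝ) (q₀ : EuclideanSpace ℝ (Fin n))
    (u : Control k a b) : EuclideanSpace ℝ (Fin n) :=
  if h : ∃ γ : ℝ → EuclideanSpace ℝ (Fin n), HasControl f γ u ∧ γ a = q₀ then h.choose b else q₀

/-- The extended end-point map `u ↦ (F_{q₀}(u), J(u))`, where `J(u) = ‖u‖` is the length. -/
def extendedEndpointMap {n k : ℕ} (f : Frame n k) (a b : ℝ) (q₀ : EuclideanSpace ℝ (Fin n))
    (u : Control k a b) : EuclideanSpace ℝ (Fin n) × ℝ :=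
  (endpointMap f a b q₀ u, ‖u‖)

/-- `L` is the differential of `Φ` at `x`, in terms of directional derivatives:
`L v = d/ds Φ(x + s v)` at `s = 0`, with `L` linear and continuous. (The length functional on `L¹`
is not Fréchet differentiable.) -/
def HasDifferential {X Y : Type*} [NormedAddCommGroup X] [NormedSpace ℝ X]
    [NormedAddCommGroup Y] [NormedSpace ℝ Y] (Φ : X → Y) (L : X →L[ℝ] Y) (x : X) : Prop :=
  ∀ v, HasLineDerivAt ℝ Φ (L v) x v

/-- `u` is a strictly singular critical point of the extended end-point map `ℱ`: the differential
`d_u ℱ` exists, it is not surjective, and every `(ℓ, ℓ₀)` that annihilates its image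
has `ℓ₀ = 0`. -/
def IsStrictlySingularControl {n k : ℕ} (f : Frame n k) (a b : ℝ)
    (q₀ : EuclideanSpace ℝ (Fin n)) (u : Control k a b) : Prop :=
  ∃ L : Control k a b →L[ℝ] EuclideanSpace ℝ (Fin n) × ℝ,
    HasDifferential (extendedEndpointMap f a b q₀) L u ∧
    ¬ Function.Surjective L ∧
    ∀ (ℓ : EuclideanSpace ℝ (Fin n) →L[ℝ] ℝ) (ℓ₀ : ℝ),
      (∀ v, ℓ (L v).1 + ℓ₀ * (L v).2 = 0) → ℓ₀ = 0

/-- The pair `(γ, u)` on `[a, b]` satisfies the Pontryagin Maximum Principle for the length: there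
are a constant `ℓ₀ ≤ 0` and an absolutely continuous curve of covectors `ℓ(t) ∈ T*_{γ(t)} ℝⁿ`,
with `(ℓ(t), ℓ₀) ≠ 0`, solving the adjoint equation `ℓ' = - ℓ ∘ D f_u(γ)` and such that `u(t)`
maximizes the Hamiltonian `w ↦ ⟨ℓ(t), f_w(γ(t))⟩ + ℓ₀ |w|` for a.e. `t`. -/
def SatisfiesPMP {n k : ℕ} (f : Frame n k) {a b : ℝ} (γ : ℝ → EuclideanSpace ℝ (Fin n))
    (u : Control k a b) : Prop :=
  ∃ (ℓ : ℝ → EuclideanSpace ℝ (Fin n) →L[ℝ] ℝ) (ℓ₀ : ℝ),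
    ℓ₀ ≤ 0 ∧
    (∀ t ∈ Icc a b, ℓ t ≠ 0 ∨ ℓ₀ ≠ 0) ∧
    AbsolutelyContinuousOnInterval ℓ a b ∧
    (∀ᵐ t ∂(volume.restrict (Icc a b)),
      HasDerivAt ℓ (-((ℓ t).comp (fderiv ℝ (f.comb (u t)) (γ t)))) t) ∧
    (∀ᵐ t ∂(volume.restrict (Icc a b)), ∀ w : EuclideanSpace ℝ (Fin k),
      ℓ t (f.comb w (γ t)) + ℓ₀ * ‖w‖ ≤ ℓ t (f.comb (u t) (γ t)) + ℓ₀ * ‖u t‖)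

/-- `γ` restricted to `[a, b]` is a strictly singular extremal: it is a horizontal curve that
satisfies the Pontryagin Maximum Principle, and its control is strictly singular. -/
def IsStrictlySingularExtremal {n k : ℕ} (f : Frame n k) (a b : ℝ)
    (γ : ℝ → EuclideanSpace ℝ (Fin n)) : Prop :=
  ∃ u : Control k a b, HasControl f γ u ∧ SatisfiesPMP f γ u ∧
    IsStrictlySingularControl f a b (γ a) u

/-- `γ` restricted to `[a, b]` is horizontal and not longer than any horizontal curve with the same
end-points. (A horizontal curve on any other interval becomes one on `[a, b]` of the same length
by an affine change of parameter.) -/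
def IsLengthMinimizing {n k : ℕ} (f : Frame n k) (a b : ℝ)
    (γ : ℝ → EuclideanSpace ℝ (Fin n)) : Prop :=
  ∃ u : Control k a b, HasControl f γ u ∧
    ∀ (η : ℝ → EuclideanSpace ℝ (Fin n)) (v : Control k a b), HasControl f η v →
      η a = γ a → η b = γ b → ‖u‖ ≤ ‖v‖

/-- `γ` restricted to `[a, b]` is length-minimizing, and it is the only length-minimizing curve
between its end-points, up to a monotone change of parameter. -/
def IsUniqueLengthMinimizing {n k : ℕ} (f : Frame n k) (a b : ℝ)
    (γ : ℝ → EuclideanSpace ℝ (Fin n)) : Prop :=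
  IsLengthMinimizing f a b γ ∧
    ∀ η : ℝ → EuclideanSpace ℝ (Fin n), IsLengthMinimizing f a b η → η a = γ a → η b = γ b →
      ∃ φ : ℝ → ℝ, ContinuousOn φ (Icc a b) ∧ MonotoneOn φ (Icc a b) ∧ φ a = a ∧ φ b = b ∧
        ∀ t ∈ Icc a b, η t = γ (φ t)

/-- The curve `γ`, on the interval `I`, is locally length-minimizing: every `t ∈ I` has a
neighbourhood such that `γ` is length-minimizing on the compact subintervals of `I` in it. -/
def IsLocallyLengthMinimizing {n k : ℕ} (f : Frame n k) (I : Set ℝ)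
    (γ : ℝ → EuclideanSpace ℝ (Fin n)) : Prop :=
  ∀ t ∈ I, ∃ ε > 0, ∀ a ∈ I, ∀ b ∈ I, a < b → |a - t| < ε → |b - t| < ε →
    IsLengthMinimizing f a b γ

/-- `Φ` is open at `x`: it maps neighbourhoods of `x` to neighbourhoods of `Φ x`. -/
def IsOpenAt {X Y : Type*} [TopologicalSpace X] [TopologicalSpace Y] (Φ : X → Y) (x : X) : Prop :=
  ∀ U ∈ 𝓝 x, Φ '' U ∈ 𝓝 (Φ x)

/-- The fields `f₁ = ∂₁` and `f₂ = (1 - x₁) ∂₂ + x₁ᵖ ∂₃` on `ℝ³`. -/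
def exampleFrame (p : ℕ) : Frame 3 2 :=
  ![fun _ => !₂[1, 0, 0], fun x => !₂[0, 1 - x 0, x 0 ^ p]]

/-- The curve `γ(t) = (0, t, 0)`. -/
def exampleCurve (t : ℝ) : EuclideanSpace ℝ (Fin 3) := !₂[0, t, 0]

end SubRiem

end

noncomputable section

namespace SubRiem

/-! ### Absolutely continuous functions -/

/-! The system is triangular: `x₁` is the primitive of `u₁`, and `x₂`, `x₃` are then integrals of
`(1 - x₁) u₂` and `x₁ᵖ u₂`. Trajectories are global and end-points are explicit integrals.

(i) The covector `dx₃` annihilates `Δ` along `γ`, and for `p ≥ 2` it is a constant adjoint solution.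
Perturbing `(0, 1)` by `s v` moves `x₃` only by `O(sᵖ)`, so the differential misses `∂₃`; it is
large enough in the other directions to force `ℓ₀ = 0`.

(ii) Let a competitor have control `v` with `‖v‖ ≤ b - a`, and put `M = max |x₁|`, `D = ∫ (|v| -
v₂)`. Going from `0` to `±M` and back gives `2 M^(p+1) ≤ (p+1) ∫ x₁ᵖ |v|`. Since `∫ x₁ᵖ v₂ = 0` and
`x₁ᵖ ≥ 0`, the last integral is at most `Mᵖ D`. The equation for `x₂` gives `D ≤ -∫ x₁ v₂ ≤ M ‖v‖`.
If `M > 0`, then `2 ≤ (p+1) ‖v‖`, against `b - a < 2/(p+1)`. So the competitor lies in `x₁ = 0`,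
where length dominates displacement (`HasControl.coord_zero_eq_zero`,
`HasControl.length_ge_of_coord_zero`).

(iii) For `p = 3` the weight changes sign. A profile `x₁ = ε w` with `∫ w³ = 0` and `∫ w < 0` closes
up in `x₃`, gains length at order `ε` through the factor `1 - x₁`, and costs only `O(ε²)`. For
openness, a bump of size `c` contributes an odd cubic term to `∫ x₁³`, so the intermediate value
theorem reaches every nearby value of `x₃`. -/

theorem AbsolutelyContinuousOnInterval.comp_lipschitzWith {X Y : Type*} [PseudoMetricSpace X]
    [PseudoMetricSpace Y] {f : ℝ → X} {g : X → Y} {K : NNReal} {a b : ℝ} (hg : LipschitzWith K g)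
    (hf : AbsolutelyContinuousOnInterval f a b) :
    AbsolutelyContinuousOnInterval (fun t => g (f t)) a b := by
  have h := Tendsto.const_mul (K : ℝ) hf
  rw [mul_zero] at h
  refine squeeze_zero (fun E => Finset.sum_nonneg fun i _ => dist_nonneg) (fun E => ?_) h
  rw [Finset.mul_sum]
  exact Finset.sum_le_sum fun i _ => hg.dist_le_mul _ _

theorem AbsolutelyContinuousOnInterval.of_coord {n : ℕ} {γ : ℝ → EuclideanSpace ℝ (Fin n)}
    {a b : ℝ} (h : ∀ i, AbsolutelyContinuousOnInterval (fun t => γ t i) a b) :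
    AbsolutelyContinuousOnInterval γ a b := by
  have hs := tendsto_finsetSum Finset.univ fun i _ => h i
  rw [Finset.sum_const_zero] at hs
  refine squeeze_zero (fun E => Finset.sum_nonneg fun i _ => dist_nonneg) (fun E => ?_) hs
  rw [Finset.sum_comm]
  refine Finset.sum_le_sum fun i _ => ?_
  rw [EuclideanSpace.dist_eq]
  -- The Euclidean distance is at most the sum of the coordinate distances.
  refine (Real.sqrt_le_sqrt (Finset.sum_sq_le_sq_sum_of_nonneg fun j _ => dist_nonneg)).trans ?_
  rw [Real.sqrt_sq (Finset.sum_nonneg fun j _ => dist_nonneg)]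

theorem AbsolutelyContinuousOnInterval.coord {n : ℕ} {γ : ℝ → EuclideanSpace ℝ (Fin n)}
    {a b : ℝ} (h : AbsolutelyContinuousOnInterval γ a b) (i : Fin n) :
    AbsolutelyContinuousOnInterval (fun t => γ t i) a b :=
  AbsolutelyContinuousOnInterval.comp_lipschitzWith
    (EuclideanSpace.proj (𝕜 := ℝ) i : EuclideanSpace ℝ (Fin n) →L[ℝ] ℝ).lipschitz h

theorem AbsolutelyContinuousOnInterval.const {X : Type*} [PseudoMetricSpace X] (x : X) (a b : ℝ) :
    AbsolutelyContinuousOnInterval (fun _ => x) a b := by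
  simpa [AbsolutelyContinuousOnInterval] using tendsto_const_nhds

theorem AbsolutelyContinuousOnInterval.fun_pow {f : ℝ → ℝ} {a b : ℝ}
    (hf : AbsolutelyContinuousOnInterval f a b) (n : ℕ) :
    AbsolutelyContinuousOnInterval (fun t => f t ^ n) a b := by
  induction n with
  | zero => simpa using AbsolutelyContinuousOnInterval.const (1 : ℝ) a b
  | succ n ih => simpa only [pow_succ] using ih.fun_mul hf

/-- The fundamental theorem of calculus for an absolutely continuous function. -/
theorem AbsolutelyContinuousOnInterval.integral_eq_sub {f g : ℝ → ℝ} {a b s t : ℝ} (hab : a ≤ b)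
    (hf : AbsolutelyContinuousOnInterval f a b)
    (hfg : ∀ᵐ t ∂(volume.restrict (Icc a b)), HasDerivAt f (g t) t)
    (hs : s ∈ Icc a b) (ht : t ∈ Icc a b) : ∫ x in s..t, g x = f t - f s := by
  have hsub : uIcc s t ⊆ uIcc a b := by
    rw [uIcc_of_le hab]; exact ordConnected_Icc.uIcc_subset hs ht
  rw [← (hf.mono hsub).integral_deriv_eq_sub]
  refine intervalIntegral.integral_congr_ae ?_
  rw [ae_restrict_iff' measurableSet_Icc] at hfg
  filter_upwards [hfg] with x hx hxm
  rw [(hx ?_).deriv]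
  have := hsub (uIoc_subset_uIcc hxm)
  rwa [uIcc_of_le hab] at this

theorem hasDerivAt_coord_iff {n : ℕ} {γ : ℝ → EuclideanSpace ℝ (Fin n)}
    {v : EuclideanSpace ℝ (Fin n)} {t : ℝ} :
    HasDerivAt γ v t ↔ ∀ i, HasDerivAt (fun s => γ s i) (v i) t := by
  simp only [hasDerivAt_iff_hasFDerivAt, ← hasFDerivWithinAt_univ]
  rw [hasFDerivWithinAt_piLp]
  refine forall_congr' fun i => ?_
  have : (PiLp.proj 2 (fun _ : Fin n => ℝ) i : _ →L[ℝ] ℝ).comp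
      (ContinuousLinearMap.toSpanSingleton ℝ v) = ContinuousLinearMap.toSpanSingleton ℝ (v i) := by
    ext; simp
  rw [← this]

/-! ### Controls -/

variable {k : ℕ} {a b : ℝ}

theorem Control.integrable (u : Control k a b) :
    Integrable (fun t => u t) (volume.restrict (Icc a b)) := L1.integrable_coeFn u

theorem intervalIntegrable_of_integrable_restrict {E : Type*} [NormedAddCommGroup E] {f : ℝ → E}
    (hab : a ≤ b) (hf : Integrable f (volume.restrict (Icc a b))) :
    IntervalIntegrable f volume a b := by
  rw [intervalIntegrable_iff_integrableOn_Icc_of_le hab]; exact hf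

theorem Control.intervalIntegrable (hab : a ≤ b) (u : Control k a b) :
    IntervalIntegrable (fun t => u t) volume a b :=
  intervalIntegrable_of_integrable_restrict hab u.integrable

theorem Control.intervalIntegrable_coord (hab : a ≤ b) (u : Control k a b) (i : Fin k) :
    IntervalIntegrable (fun t => u t i) volume a b :=
  intervalIntegrable_of_integrable_restrict hab
    ((EuclideanSpace.proj (𝕜 := ℝ) i : EuclideanSpace ℝ (Fin k) →L[ℝ] ℝ).integrable_comp
      u.integrable)

theorem integral_restrict_Icc {E : Type*} [NormedAddCommGroup E] [NormedSpace ℝ E] {f : ℝ → E}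
    (hab : a ≤ b) : ∫ t, f t ∂(volume.restrict (Icc a b)) = ∫ t in a..b, f t := by
  rw [intervalIntegral.integral_of_le hab, integral_Icc_eq_integral_Ioc]

theorem Control.norm_eq_integral (hab : a ≤ b) (u : Control k a b) :
    ‖u‖ = ∫ t in a..b, ‖u t‖ := by
  rw [L1.norm_eq_integral_norm, integral_restrict_Icc hab]

theorem integral_congr_of_ae_restrict {E : Type*} [NormedAddCommGroup E] [NormedSpace ℝ E]
    {f g : ℝ → E} {s t : ℝ} (h : ∀ᵐ x ∂(volume.restrict (Icc a b)), f x = g x)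
    (hs : s ∈ Icc a b) (ht : t ∈ Icc a b) : ∫ x in s..t, f x = ∫ x in s..t, g x := by
  refine intervalIntegral.integral_congr_ae ?_
  rw [ae_restrict_iff' measurableSet_Icc] at h
  filter_upwards [h] with x hx hxm
  exact hx (ordConnected_Icc.uIcc_subset hs ht (uIoc_subset_uIcc hxm))

/-- The control with a continuous representative `g`. -/
def contControl (a b : ℝ) (g : ℝ → EuclideanSpace ℝ (Fin k)) (hg : Continuous g) : Control k a b :=
  (memLp_one_iff_integrable.2 (hg.integrableOn_Icc (a := a) (b := b))).toLp g

theorem contControl_ae (g : ℝ → EuclideanSpace ℝ (Fin k)) (hg : Continuous g) :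
    ∀ᵐ t ∂(volume.restrict (Icc a b)), contControl a b g hg t = g t :=
  MemLp.coeFn_toLp _

theorem norm_contControl (hab : a ≤ b) (g : ℝ → EuclideanSpace ℝ (Fin k)) (hg : Continuous g) :
    ‖contControl a b g hg‖ = ∫ t in a..b, ‖g t‖ := by
  rw [Control.norm_eq_integral hab]
  exact integral_congr_of_ae_restrict ((contControl_ae g hg).mono fun t ht => by rw [ht])
    (left_mem_Icc.2 hab) (right_mem_Icc.2 hab)

theorem contControl_sub (g h : ℝ → EuclideanSpace ℝ (Fin k)) (hg : Continuous g)
    (hh : Continuous h) :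
    contControl a b g hg - contControl a b h hh = contControl a b (g - h) (hg.sub hh) :=
  (MemLp.toLp_sub _ _).symm

/-! ### Trajectories of the example -/

variable {p : ℕ}

theorem exampleFrame_comb (w : EuclideanSpace ℝ (Fin 2)) (x : EuclideanSpace ℝ (Fin 3)) :
    (exampleFrame p).comb w x = !₂[w 0, (1 - x 0) * w 1, x 0 ^ p * w 1] := by
  ext i
  fin_cases i <;> simp [Frame.comb, exampleFrame, Fin.sum_univ_two, mul_comm]

theorem hasControl_example_iff {γ : ℝ → EuclideanSpace ℝ (Fin 3)} {u : Control 2 a b} :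
    HasControl (exampleFrame p) γ u ↔
      (∀ i, AbsolutelyContinuousOnInterval (fun t => γ t i) a b) ∧
      ∀ᵐ t ∂(volume.restrict (Icc a b)),
        HasDerivAt (fun s => γ s 0) (u t 0) t ∧
        HasDerivAt (fun s => γ s 1) ((1 - γ t 0) * u t 1) t ∧
        HasDerivAt (fun s => γ s 2) (γ t 0 ^ p * u t 1) t := by
  have key : (∀ᵐ t ∂(volume.restrict (Icc a b)),
      HasDerivAt γ ((exampleFrame p).comb (u t) (γ t)) t) ↔
      ∀ᵐ t ∂(volume.restrict (Icc a b)),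
        HasDerivAt (fun s => γ s 0) (u t 0) t ∧
        HasDerivAt (fun s => γ s 1) ((1 - γ t 0) * u t 1) t ∧
        HasDerivAt (fun s => γ s 2) (γ t 0 ^ p * u t 1) t := by
    refine eventually_congr (Eventually.of_forall fun t => ?_)
    rw [hasDerivAt_coord_iff, exampleFrame_comb, Fin.forall_fin_succ, Fin.forall_fin_succ,
      Fin.forall_fin_succ]
    simp
  exact ⟨fun h => ⟨fun i => AbsolutelyContinuousOnInterval.coord h.ac i, key.1 h.ode⟩,
    fun h => ⟨AbsolutelyContinuousOnInterval.of_coord h.1, key.2 h.2⟩⟩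

theorem HasControl.sub_zero_eq (hab : a ≤ b) {γ : ℝ → EuclideanSpace ℝ (Fin 3)} {u : Control 2 a b}
    (h : HasControl (exampleFrame p) γ u) {s t : ℝ} (hs : s ∈ Icc a b) (ht : t ∈ Icc a b) :
    γ t 0 - γ s 0 = ∫ x in s..t, u x 0 := by
  obtain ⟨h1, h2⟩ := hasControl_example_iff.1 h
  exact (AbsolutelyContinuousOnInterval.integral_eq_sub hab (h1 0) (h2.mono fun _ h => h.1)
    hs ht).symm

theorem HasControl.sub_one_eq (hab : a ≤ b) {γ : ℝ → EuclideanSpace ℝ (Fin 3)} {u : Control 2 a b}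
    (h : HasControl (exampleFrame p) γ u) {s t : ℝ} (hs : s ∈ Icc a b) (ht : t ∈ Icc a b) :
    γ t 1 - γ s 1 = ∫ x in s..t, (1 - γ x 0) * u x 1 := by
  obtain ⟨h1, h2⟩ := hasControl_example_iff.1 h
  exact (AbsolutelyContinuousOnInterval.integral_eq_sub hab (h1 1) (h2.mono fun _ h => h.2.1)
    hs ht).symm

theorem HasControl.sub_two_eq (hab : a ≤ b) {γ : ℝ → EuclideanSpace ℝ (Fin 3)} {u : Control 2 a b}
    (h : HasControl (exampleFrame p) γ u) {s t : ℝ} (hs : s ∈ Icc a b) (ht : t ∈ Icc a b) :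
    γ t 2 - γ s 2 = ∫ x in s..t, γ x 0 ^ p * u x 1 := by
  obtain ⟨h1, h2⟩ := hasControl_example_iff.1 h
  exact (AbsolutelyContinuousOnInterval.integral_eq_sub hab (h1 2) (h2.mono fun _ h => h.2.2)
    hs ht).symm

/-- The endpoint of the trajectory of `u` whose first coordinate is `x`. -/
theorem HasControl.endpoint_eq (hab : a ≤ b) {γ : ℝ → EuclideanSpace ℝ (Fin 3)} {u : Control 2 a b}
    (h : HasControl (exampleFrame p) γ u) {x : ℝ → ℝ}
    (hx : ∀ t ∈ Icc a b, γ a 0 + ∫ s in a..t, u s 0 = x t) :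
    γ b = !₂[x b, γ a 1 + ∫ t in a..b, (1 - x t) * u t 1, γ a 2 + ∫ t in a..b, x t ^ p * u t 1] := by
  have ha := left_mem_Icc.2 hab
  have hb := right_mem_Icc.2 hab
  have h0 : ∀ t ∈ Icc a b, γ t 0 = x t := fun t ht => by
    rw [← hx t ht, ← h.sub_zero_eq hab ha ht]; ring
  have e1 := h.sub_one_eq hab ha hb
  have e2 := h.sub_two_eq hab ha hb
  have hc1 : ∫ t in a..b, (1 - γ t 0) * u t 1 = ∫ t in a..b, (1 - x t) * u t 1 :=
    intervalIntegral.integral_congr fun t ht => by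
      rw [uIcc_of_le hab] at ht; simp only [h0 t ht]
  have hc2 : ∫ t in a..b, γ t 0 ^ p * u t 1 = ∫ t in a..b, x t ^ p * u t 1 :=
    intervalIntegral.integral_congr fun t ht => by
      rw [uIcc_of_le hab] at ht; simp only [h0 t ht]
  ext i
  fin_cases i
  · simpa using h0 b hb
  · simp only [Fin.mk_one, Fin.isValue, Matrix.cons_val_one, Matrix.cons_val_zero]
    rw [← hc1, ← e1]; ring
  · simp only [Fin.reduceFinMk, Fin.isValue, Matrix.cons_val]
    rw [← hc2, ← e2]; ring

/-- The trajectory of `u` starting from `q` at time `a`. -/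
def exampleTraj (p : ℕ) (q : EuclideanSpace ℝ (Fin 3)) (u : Control 2 a b) (t : ℝ) :
    EuclideanSpace ℝ (Fin 3) :=
  !₂[q 0 + ∫ s in a..t, u s 0,
    q 1 + ∫ s in a..t, (1 - (q 0 + ∫ r in a..s, u r 0)) * u s 1,
    q 2 + ∫ s in a..t, (q 0 + ∫ r in a..s, u r 0) ^ p * u s 1]

theorem exampleTraj_left (q : EuclideanSpace ℝ (Fin 3)) (u : Control 2 a b) :
    exampleTraj p q u a = q := by
  ext i
  fin_cases i <;> simp [exampleTraj]

theorem continuousOn_primitive_coord (hab : a ≤ b) (u : Control 2 a b) (i : Fin 2) :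
    ContinuousOn (fun t => ∫ s in a..t, u s i) (Icc a b) := by
  have h := ((u.intervalIntegrable_coord hab i).absolutelyContinuousOnInterval_intervalIntegral
    left_mem_uIcc).continuousOn
  rwa [uIcc_of_le hab] at h

theorem hasControl_exampleTraj (hab : a ≤ b) (q : EuclideanSpace ℝ (Fin 3)) (u : Control 2 a b) :
    HasControl (exampleFrame p) (exampleTraj p q u) u := by
  have hX := continuousOn_primitive_coord hab u 0
  replace hX : ContinuousOn (fun t => ∫ s in a..t, u s 0) (uIcc a b) := by rwa [uIcc_of_le hab]
  have i0 := u.intervalIntegrable_coord hab 0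
  have i1 : IntervalIntegrable (fun s => (1 - (q 0 + ∫ r in a..s, u r 0)) * u s 1) volume a b :=
    (u.intervalIntegrable_coord hab 1).continuousOn_mul (by fun_prop)
  have i2 : IntervalIntegrable (fun s => (q 0 + ∫ r in a..s, u r 0) ^ p * u s 1) volume a b :=
    (u.intervalIntegrable_coord hab 1).continuousOn_mul (by fun_prop)
  have ac : ∀ (c : ℝ) {g : ℝ → ℝ}, IntervalIntegrable g volume a b →
      AbsolutelyContinuousOnInterval (fun t => c + ∫ s in a..t, g s) a b := fun c g hg =>
    (AbsolutelyContinuousOnInterval.const c a b).fun_add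
      (hg.absolutelyContinuousOnInterval_intervalIntegral left_mem_uIcc)
  have der : ∀ (c : ℝ) {g : ℝ → ℝ}, IntervalIntegrable g volume a b →
      ∀ᵐ t ∂(volume.restrict (Icc a b)), HasDerivAt (fun t => c + ∫ s in a..t, g s) (g t) t :=
    fun c g hg => by
      rw [ae_restrict_iff' measurableSet_Icc]
      filter_upwards [hg.ae_hasDerivAt_integral] with t ht htm
      rw [uIcc_of_le hab] at ht
      exact (ht htm a (left_mem_Icc.2 hab)).const_add c
  refine hasControl_example_iff.2 ⟨fun i => ?_, ?_⟩
  · fin_cases i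
    · exact ac _ i0
    · exact ac _ i1
    · exact ac _ i2
  · filter_upwards [der (q 0) i0, der (q 1) i1, der (q 2) i2] with t h0 h1 h2
    exact ⟨h0, h1, h2⟩

/-- A trajectory exists by quadrature, so the default value never occurs; the formula for the
end-point holds for every trajectory, hence for the chosen one. The free function `x` lets explicit
profiles be substituted for the primitive. -/
theorem endpointMap_exampleFrame (hab : a ≤ b) (q : EuclideanSpace ℝ (Fin 3)) (u : Control 2 a b)
    {x : ℝ → ℝ} (hx : ∀ t ∈ Icc a b, q 0 + ∫ s in a..t, u s 0 = x t) :
    endpointMap (exampleFrame p) a b q u =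
      !₂[x b, q 1 + ∫ t in a..b, (1 - x t) * u t 1, q 2 + ∫ t in a..b, x t ^ p * u t 1] := by
  have h : ∃ γ : ℝ → EuclideanSpace ℝ (Fin 3), HasControl (exampleFrame p) γ u ∧ γ a = q :=
    ⟨_, hasControl_exampleTraj hab q u, exampleTraj_left q u⟩
  rw [endpointMap, dif_pos h]
  obtain ⟨h1, h2⟩ := h.choose_spec
  have := h1.endpoint_eq hab (x := x) (by rwa [h2])
  rwa [h2] at this

/-- The constant control `(0, 1)`. -/
def exampleControl (a b : ℝ) : Control 2 a b := contControl a b (fun _ => !₂[0, 1]) continuous_const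

theorem exampleControl_ae :
    ∀ᵐ t ∂(volume.restrict (Icc a b)), exampleControl a b t = !₂[0, 1] :=
  contControl_ae _ continuous_const

theorem norm_exampleControl (hab : a ≤ b) : ‖exampleControl a b‖ = b - a := by
  rw [exampleControl, norm_contControl hab]
  simp [EuclideanSpace.norm_eq]

theorem hasControl_exampleCurve (hp : p ≠ 0) :
    HasControl (exampleFrame p) exampleCurve (exampleControl a b) := by
  refine hasControl_example_iff.2 ⟨fun i => ?_, ?_⟩
  · fin_cases i
    · exact AbsolutelyContinuousOnInterval.const _ a b
    · exact (LipschitzWith.id.lipschitzOnWith (s := uIcc a b)).absolutelyContinuousOnInterval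
    · exact AbsolutelyContinuousOnInterval.const _ a b
  · filter_upwards [exampleControl_ae] with t ht
    rw [ht]
    simp only [exampleCurve]
    refine ⟨?_, ?_, ?_⟩
    · simpa using hasDerivAt_const t (0 : ℝ)
    · simpa using hasDerivAt_id' t
    · simpa [hp] using hasDerivAt_const t (0 : ℝ)

/-! ### Strict singularity -/

/-- The abnormal lift is the constant covector `dx₃` with `ℓ₀ = 0`. Its Hamiltonian `x₁ᵖ w₂`
vanishes on `γ` for every `w`, and its `x`-derivative vanishes there because `p ≥ 2`. -/
theorem satisfiesPMP_exampleCurve (hp : 2 ≤ p) :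
    SatisfiesPMP (exampleFrame p) exampleCurve (exampleControl a b) := by
  have hp0 : p ≠ 0 := by omega
  set π : EuclideanSpace ℝ (Fin 3) →L[ℝ] ℝ := EuclideanSpace.proj 2 with hπ
  have hπ_apply : ∀ x, π x = x 2 := fun x => rfl
  refine ⟨fun _ => π, 0, le_rfl, fun t _ => Or.inl fun h => ?_,
    AbsolutelyContinuousOnInterval.const _ a b, Eventually.of_forall fun t => ?_,
    Eventually.of_forall fun t w => ?_⟩
  · have := DFunLike.congr_fun h !₂[0, 0, 1]
    simp [hπ_apply] at this
  · set w := exampleControl a b t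
    have hd : Differentiable ℝ ((exampleFrame p).comb w) := by
      rw [funext (exampleFrame_comb w), differentiable_piLp]
      intro i
      fin_cases i <;> simp <;> fun_prop
    have h1 : HasFDerivAt (fun x : EuclideanSpace ℝ (Fin 3) => x 0 ^ p * w 1)
        (0 : EuclideanSpace ℝ (Fin 3) →L[ℝ] ℝ) (exampleCurve t) := by
      have h2 : HasFDerivAt (fun x : EuclideanSpace ℝ (Fin 3) => x 0)
          (EuclideanSpace.proj 0 : EuclideanSpace ℝ (Fin 3) →L[ℝ] ℝ) (exampleCurve t) :=
        (EuclideanSpace.proj 0 : EuclideanSpace ℝ (Fin 3) →L[ℝ] ℝ).hasFDerivAt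
      refine ((h2.pow p).mul_const (w 1)).congr_fderiv ?_
      simp [exampleCurve, show p - 1 ≠ 0 by omega]
    have h3 : π.comp (fderiv ℝ ((exampleFrame p).comb w) (exampleCurve t)) = 0 := by
      refine (π.hasFDerivAt.comp _ (hd _).hasFDerivAt).unique (h1.congr_of_eventuallyEq ?_)
      exact Eventually.of_forall fun x => by simp [hπ_apply, exampleFrame_comb]
    rw [h3, neg_zero]
    exact hasDerivAt_const _ _
  · simp [hπ_apply, exampleFrame_comb, exampleCurve, hp0]

/-- The integral of the `i`-th coordinate of a control. -/
def integralCoord (a b : ℝ) (i : Fin 2) : Control 2 a b →L[ℝ] ℝ :=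
  (L1.integralCLM (E := ℝ) (μ := volume.restrict (Icc a b))).comp ((EuclideanSpace.proj i : EuclideanSpace ℝ (Fin 2) →L[ℝ] ℝ).compLpL 1
    (volume.restrict (Icc a b)))

theorem integralCoord_apply (hab : a ≤ b) (i : Fin 2) (v : Control 2 a b) :
    integralCoord a b i v = ∫ t in a..b, v t i := by
  rw [← integral_restrict_Icc hab]
  change L1.integralCLM ((EuclideanSpace.proj i : EuclideanSpace ℝ (Fin 2) →L[ℝ] ℝ).compLp v) = _
  rw [← L1.integral_eq, L1.integral_eq_integral]
  exact integral_congr_ae ((ContinuousLinearMap.coeFn_compLp _ v).mono fun t ht => by rw [ht]; rfl)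

theorem Control.coord_add (u v : Control 2 a b) (i : Fin 2) :
    ∀ᵐ t ∂(volume.restrict (Icc a b)), (u + v) t i = u t i + v t i := by
  filter_upwards [Lp.coeFn_add u v] with t ht
  rw [ht]; rfl

theorem Control.coord_smul (c : ℝ) (v : Control 2 a b) (i : Fin 2) :
    ∀ᵐ t ∂(volume.restrict (Icc a b)), (c • v) t i = c * v t i := by
  filter_upwards [Lp.coeFn_smul c v] with t ht
  rw [ht]; rfl

theorem Control.abs_integral_coord_le (hab : a ≤ b) (v : Control 2 a b) (i : Fin 2) {t : ℝ}
    (ht : t ∈ Icc a b) : |∫ s in a..t, v s i| ≤ ‖v‖ := by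
  rw [v.norm_eq_integral hab, ← Real.norm_eq_abs]
  have hi := (v.intervalIntegrable hab).norm
  refine (intervalIntegral.norm_integral_le_of_norm_le (g := fun s => ‖v s‖) ht.1
    (Eventually.of_forall fun s _ => PiLp.norm_apply_le _ _)
    (hi.mono_set (uIcc_subset_uIcc_left (by rwa [uIcc_of_le hab])))).trans ?_
  exact intervalIntegral.integral_mono_interval le_rfl ht.1 ht.2
    (Eventually.of_forall fun s => norm_nonneg _) hi

/-- The integral of the primitive of the first coordinate of a control. -/
def doubleIntegral (hab : a ≤ b) : Control 2 a b →L[ℝ] ℝ :=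
  LinearMap.mkContinuous
    { toFun := fun v => ∫ t in a..b, ∫ s in a..t, v s 0
      map_add' := fun u v => by
        have hc := fun w : Control 2 a b => (continuousOn_primitive_coord hab w 0)
        rw [← intervalIntegral.integral_add ((hc u).intervalIntegrable_of_Icc hab)
          ((hc v).intervalIntegrable_of_Icc hab)]
        refine intervalIntegral.integral_congr fun t ht => ?_
        rw [uIcc_of_le hab] at ht
        have hi := fun w : Control 2 a b => (w.intervalIntegrable_coord hab 0).mono_set
          (uIcc_subset_uIcc_left (show t ∈ uIcc a b by rwa [uIcc_of_le hab]))
        simp only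
        rw [← intervalIntegral.integral_add (hi u) (hi v)]
        exact integral_congr_of_ae_restrict (u.coord_add v 0) (left_mem_Icc.2 hab) ht
      map_smul' := fun c v => by
        simp only [RingHom.id_apply, smul_eq_mul]
        rw [← intervalIntegral.integral_const_mul]
        refine intervalIntegral.integral_congr fun t ht => ?_
        rw [uIcc_of_le hab] at ht
        rw [← intervalIntegral.integral_const_mul]
        exact integral_congr_of_ae_restrict (v.coord_smul c 0) (left_mem_Icc.2 hab) ht }
    (b - a) fun v => by
      refine (intervalIntegral.norm_integral_le_of_norm_le_const (C := ‖v‖) fun t ht => ?_).trans ?_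
      · rw [uIoc_of_le hab] at ht
        exact v.abs_integral_coord_le hab 0 (Ioc_subset_Icc_self ht)
      · rw [abs_of_nonneg (sub_nonneg.2 hab), mul_comm]

theorem doubleIntegral_apply (hab : a ≤ b) (v : Control 2 a b) :
    doubleIntegral hab v = ∫ t in a..b, ∫ s in a..t, v s 0 := rfl

/-- The differential of the extended end-point map at `exampleControl`. -/
def exampleDifferential (hab : a ≤ b) : Control 2 a b →L[ℝ] EuclideanSpace ℝ (Fin 3) × ℝ :=
  ((integralCoord a b 0).smulRight (!₂[1, 0, 0] : EuclideanSpace ℝ (Fin 3)) +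
    (integralCoord a b 1 - doubleIntegral hab).smulRight
      (!₂[0, 1, 0] : EuclideanSpace ℝ (Fin 3))).prod (integralCoord a b 1)

/-- Since `(0, 1)` is a unit vector, `|(0, 1) + s v(t)|` is differentiable at `s = 0` for each `t`,
with derivative `v₂(t)`. It is Lipschitz in `s` with the integrable constant `|v(t)|`, so one may
differentiate under the integral. -/
theorem hasDerivAt_norm_exampleControl (hab : a ≤ b) (v : Control 2 a b) :
    HasDerivAt (fun s : ℝ => ‖exampleControl a b + s • v‖) (integralCoord a b 1 v) 0 := by
  rw [integralCoord_apply hab, ← integral_restrict_Icc hab]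
  have hn : (fun s : ℝ => ‖exampleControl a b + s • v‖) =
      fun s => ∫ t, ‖(!₂[0, 1] : EuclideanSpace ℝ (Fin 2)) + s • v t‖
        ∂(volume.restrict (Icc a b)) := by
    ext s
    rw [L1.norm_eq_integral_norm]
    refine integral_congr_ae ?_
    filter_upwards [Lp.coeFn_add (exampleControl a b) (s • v), Lp.coeFn_smul s v,
      exampleControl_ae (a := a) (b := b)] with t h1 h2 h3
    rw [h1, Pi.add_apply, h2, h3]; rfl
  rw [hn]
  have hm : ∀ s : ℝ, Integrable (fun t => ‖(!₂[0, 1] : EuclideanSpace ℝ (Fin 2)) + s • v t‖)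
      (volume.restrict (Icc a b)) := fun s =>
    ((integrable_const _).add (v.integrable.smul s)).norm
  refine (hasDerivAt_integral_of_dominated_loc_of_lip (s := univ) (bound := fun t => ‖v t‖)
    univ_mem (Eventually.of_forall fun s => (hm s).aestronglyMeasurable) (hm 0) ?_
    (Eventually.of_forall fun t => ?_) v.integrable.norm (Eventually.of_forall fun t => ?_)).2
  · exact ((EuclideanSpace.proj (𝕜 := ℝ) 1 :
      EuclideanSpace ℝ (Fin 2) →L[ℝ] ℝ).integrable_comp v.integrable).aestronglyMeasurable
  · refine LipschitzOnWith.of_dist_le_mul fun x _ y _ => ?_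
    rw [Real.coe_nnabs, abs_norm, Real.dist_eq]
    refine (abs_norm_sub_norm_le _ _).trans ?_
    rw [add_sub_add_left_eq_sub, ← sub_smul, norm_smul, mul_comm, Real.dist_eq, Real.norm_eq_abs]
  · have hf : (fun s : ℝ => ‖(!₂[0, 1] : EuclideanSpace ℝ (Fin 2)) + s • v t‖) =
        fun s => √((s * v t 0) ^ 2 + (1 + s * v t 1) ^ 2) := by
      ext s
      simp [EuclideanSpace.norm_eq]
    rw [hf]
    have hs := hasDerivAt_id' (0 : ℝ)
    refine ((((hs.mul_const (v t 0)).fun_pow 2).fun_add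
      (((hs.mul_const (v t 1)).const_add 1).fun_pow 2)).sqrt (by norm_num)).congr_deriv ?_
    norm_num

/-- An exact polynomial expansion in `s`: the first coordinate scales linearly, so the third carries
the factor `sᵖ`, with no first-order term once `p ≥ 2`. -/
theorem endpointMap_exampleControl_add_smul (hab : a ≤ b) (v : Control 2 a b) (s : ℝ) :
    endpointMap (exampleFrame p) a b (exampleCurve a) (exampleControl a b + s • v) =
      !₂[s * ∫ t in a..b, v t 0,
        b + s * ((∫ t in a..b, v t 1) - ∫ t in a..b, ∫ r in a..t, v r 0) -
          s ^ 2 * ∫ t in a..b, (∫ r in a..t, v r 0) * v t 1,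
        s ^ p * ((∫ t in a..b, (∫ r in a..t, v r 0) ^ p) +
          s * ∫ t in a..b, (∫ r in a..t, v r 0) ^ p * v t 1)] := by
  have hma := left_mem_Icc.2 hab
  have hmb := right_mem_Icc.2 hab
  have h0 : ∀ᵐ t ∂(volume.restrict (Icc a b)), (exampleControl a b + s • v) t 0 = s * v t 0 := by
    filter_upwards [(exampleControl a b).coord_add (s • v) 0, v.coord_smul s 0,
      exampleControl_ae (a := a) (b := b)] with t h1 h2 h3
    rw [h1, h2, h3]; simp
  have h1 : ∀ᵐ t ∂(volume.restrict (Icc a b)), (exampleControl a b + s • v) t 1 = 1 + s * v t 1 := by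
    filter_upwards [(exampleControl a b).coord_add (s • v) 1, v.coord_smul s 1,
      exampleControl_ae (a := a) (b := b)] with t h1 h2 h3
    rw [h1, h2, h3]; simp
  have hX : ContinuousOn (fun t => ∫ r in a..t, v r 0) (uIcc a b) := by
    rw [uIcc_of_le hab]; exact continuousOn_primitive_coord hab v 0
  have iv1 := v.intervalIntegrable_coord hab 1
  rw [endpointMap_exampleFrame hab _ _ (x := fun t => s * ∫ r in a..t, v r 0) fun t ht => ?_]
  · have c1 : ∫ t in a..b, (1 - s * ∫ r in a..t, v r 0) * (exampleControl a b + s • v) t 1 =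
        ∫ t in a..b, ((1 - s * ∫ r in a..t, v r 0) +
          (s * v t 1 - s ^ 2 * ((∫ r in a..t, v r 0) * v t 1))) :=
      integral_congr_of_ae_restrict (h1.mono fun t ht => by rw [ht]; ring) hma hmb
    have c2 : ∫ t in a..b, (s * ∫ r in a..t, v r 0) ^ p * (exampleControl a b + s • v) t 1 =
        ∫ t in a..b, s ^ p * ((∫ r in a..t, v r 0) ^ p + s * ((∫ r in a..t, v r 0) ^ p * v t 1)) :=
      integral_congr_of_ae_restrict (h1.mono fun t ht => by rw [ht]; ring) hma hmb
    have j1 : IntervalIntegrable (fun t => (∫ r in a..t, v r 0) * v t 1) volume a b :=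
      iv1.continuousOn_mul hX
    have j2 : IntervalIntegrable (fun t => (∫ r in a..t, v r 0) ^ p * v t 1) volume a b :=
      iv1.continuousOn_mul (hX.pow p)
    have j3 : IntervalIntegrable (fun t => (∫ r in a..t, v r 0) ^ p) volume a b :=
      (hX.pow p).intervalIntegrable
    rw [c1, c2, intervalIntegral.integral_add
        ((intervalIntegrable_const).sub (hX.intervalIntegrable.const_mul s))
        ((iv1.const_mul s).sub (j1.const_mul _)),
      intervalIntegral.integral_sub intervalIntegrable_const (hX.intervalIntegrable.const_mul s),
      intervalIntegral.integral_sub (iv1.const_mul s) (j1.const_mul _),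
      intervalIntegral.integral_const_mul (s ^ p), intervalIntegral.integral_add j3
        (j2.const_mul s)]
    simp only [intervalIntegral.integral_const_mul, intervalIntegral.integral_const]
    ext i
    fin_cases i
    · simp
    · simp [exampleCurve]; ring
    · simp [exampleCurve]
  · rw [integral_congr_of_ae_restrict h0 hma ht, intervalIntegral.integral_const_mul]
    simp [exampleCurve]

theorem hasDifferential_exampleControl (hp : 2 ≤ p) (hab : a ≤ b) :
    HasDifferential (extendedEndpointMap (exampleFrame p) a b (exampleCurve a))
      (exampleDifferential hab) (exampleControl a b) := by
  intro v
  refine HasDerivAt.prodMk ?_ (hasDerivAt_norm_exampleControl hab v)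
  simp only [endpointMap_exampleControl_add_smul hab]
  have hs := hasDerivAt_id' (0 : ℝ)
  rw [hasDerivAt_coord_iff, Fin.forall_fin_succ, Fin.forall_fin_succ, Fin.forall_fin_succ]
  refine ⟨?_, ?_, ?_, fun i => i.elim0⟩
  · refine (hs.mul_const (∫ t in a..b, v t 0)).congr_deriv ?_
    simp [integralCoord_apply hab]
  · refine (((hs.mul_const ((∫ t in a..b, v t 1) - ∫ t in a..b, ∫ r in a..t, v r 0)).const_add
      b).fun_sub ((hs.fun_pow 2).mul_const (∫ t in a..b, (∫ r in a..t, v r 0) * v t 1))).congr_deriv ?_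
    simp [integralCoord_apply hab, doubleIntegral_apply]
  · refine ((hs.fun_pow p).fun_mul ((hs.mul_const (∫ t in a..b, (∫ r in a..t, v r 0) ^ p * v t 1)
      ).const_add (∫ t in a..b, (∫ r in a..t, v r 0) ^ p))).congr_deriv ?_
    simp [show p ≠ 0 by omega, show p - 1 ≠ 0 by omega]

theorem isStrictlySingularControl_exampleControl (hp : 2 ≤ p) (hab : a < b) :
    IsStrictlySingularControl (exampleFrame p) a b (exampleCurve a) (exampleControl a b) := by
  refine ⟨exampleDifferential hab.le, hasDifferential_exampleControl hp hab.le, fun hsurj => ?_,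
    fun ℓ ℓ₀ hℓ => ?_⟩
  -- The image of the differential has zero third coordinate.
  · obtain ⟨v, hv⟩ := hsurj (!₂[0, 0, 1], 0)
    have := congrArg (fun x => x.1 2) hv
    simp [exampleDifferential] at this
  · have hT := sub_pos.2 hab
    have h1 := hℓ (exampleControl a b)
    -- The primitive `(b - t)(t - a)` vanishes at both ends and is positive between them. This
    -- direction therefore changes only `x₂` to first order, not the length, and isolates `ℓ(∂₂) =
    -- 0`; the direction `(0, 1)` itself then gives `ℓ₀ = 0`.
    have hc : Continuous fun t : ℝ => (!₂[b + a - 2 * t, 0] : EuclideanSpace ℝ (Fin 2)) := by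
      fun_prop
    set w := contControl a b _ hc
    have h2 := hℓ w
    have hw0 : ∀ t ∈ Icc a b, ∫ s in a..t, w s 0 = (b - t) * (t - a) := fun t ht => by
      rw [integral_congr_of_ae_restrict (g := fun s => b + a - 2 * s)
        ((contControl_ae _ hc).mono fun t ht => by rw [ht]; simp) (left_mem_Icc.2 hab.le) ht]
      rw [intervalIntegral.integral_sub (by simp)
        (Continuous.intervalIntegrable (by fun_prop) _ _),
        intervalIntegral.integral_const_mul]
      simp
      ring
    have hw1 : ∫ s in a..b, w s 1 = 0 := by
      rw [integral_congr_of_ae_restrict (g := fun s => 0)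
        ((contControl_ae _ hc).mono fun t ht => by rw [ht]; simp) (left_mem_Icc.2 hab.le)
        (right_mem_Icc.2 hab.le)]
      simp
    have hu0 : ∀ t ∈ Icc a b, ∫ s in a..t, exampleControl a b s 0 = 0 := fun t ht => by
      rw [integral_congr_of_ae_restrict (g := fun s => 0)
        (exampleControl_ae.mono fun t ht => by rw [ht]; simp) (left_mem_Icc.2 hab.le) ht]
      simp
    have hu1 : ∫ s in a..b, exampleControl a b s 1 = b - a := by
      rw [integral_congr_of_ae_restrict (g := fun s => 1)
        (exampleControl_ae.mono fun t ht => by rw [ht]; simp) (left_mem_Icc.2 hab.le)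
        (right_mem_Icc.2 hab.le)]
      simp
    have hwd : 0 < doubleIntegral hab.le w := by
      rw [doubleIntegral_apply, intervalIntegral.integral_congr (g := fun t => (b - t) * (t - a))
        fun t ht => hw0 t (by rwa [uIcc_of_le hab.le] at ht)]
      refine intervalIntegral.intervalIntegral_pos_of_pos_on
        (Continuous.intervalIntegrable (by fun_prop) _ _) (fun t ht => ?_) hab
      exact mul_pos (sub_pos.2 ht.2) (sub_pos.2 ht.1)
    have hud : doubleIntegral hab.le (exampleControl a b) = 0 := by
      rw [doubleIntegral_apply, intervalIntegral.integral_congr (g := fun t => 0)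
        fun t ht => hu0 t (by rwa [uIcc_of_le hab.le] at ht)]
      simp
    have hmb := right_mem_Icc.2 hab.le
    simp only [exampleDifferential, ContinuousLinearMap.prod_apply, add_apply,
      ContinuousLinearMap.smulRight_apply, sub_apply, map_add, map_smul,
      integralCoord_apply hab.le, hw0 b hmb, hw1, hu0 b hmb, hu1, hud, smul_eq_mul] at h1 h2
    have h3 : ℓ !₂[0, 1, 0] = 0 := by
      have : doubleIntegral hab.le w * ℓ !₂[0, 1, 0] = 0 := by linarith
      exact (mul_eq_zero.1 this).resolve_left hwd.ne'
    rw [h3] at h1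
    have : ℓ₀ * (b - a) = 0 := by linarith
    exact (mul_eq_zero.1 this).resolve_right hT.ne'

theorem isStrictlySingularExtremal_exampleCurve (hp : 2 ≤ p) (hab : a < b) :
    IsStrictlySingularExtremal (exampleFrame p) a b exampleCurve :=
  ⟨exampleControl a b, hasControl_exampleCurve (by omega), satisfiesPMP_exampleCurve hp,
    isStrictlySingularControl_exampleControl hp hab⟩

/-! ### Length minimality for even `p` -/

theorem abs_coord_le_norm {k : ℕ} (w : EuclideanSpace ℝ (Fin k)) (i : Fin k) : |w i| ≤ ‖w‖ :=
  PiLp.norm_apply_le w i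

/-- The weighted variation of the first coordinate of a horizontal curve dominates that of a
primitive of the weight `x ↦ xᵖ`. -/
theorem HasControl.pow_succ_le_integral (hp : Even p) (hab : a ≤ b)
    {η : ℝ → EuclideanSpace ℝ (Fin 3)} {v : Control 2 a b}
    (h : HasControl (exampleFrame p) η v) {s t : ℝ} (hs : s ∈ Icc a b) (ht : t ∈ Icc a b)
    (hst : s ≤ t) :
    |η t 0 ^ (p + 1) - η s 0 ^ (p + 1)| ≤ (p + 1) * ∫ r in s..t, η r 0 ^ p * ‖v r‖ := by
  obtain ⟨h1, h2⟩ := hasControl_example_iff.1 h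
  have hd : ∀ᵐ t ∂(volume.restrict (Icc a b)),
      HasDerivAt (fun s => η s 0 ^ (p + 1)) ((p + 1) * (η t 0 ^ p * v t 0)) t := by
    filter_upwards [h2] with t ht
    refine (ht.1.fun_pow (p + 1)).congr_deriv ?_
    rw [Nat.add_sub_cancel]
    push_cast
    ring
  rw [← AbsolutelyContinuousOnInterval.integral_eq_sub hab
    (AbsolutelyContinuousOnInterval.fun_pow (h1 0) (p + 1)) hd hs ht,
    intervalIntegral.integral_const_mul, abs_mul, abs_of_nonneg (by positivity : (0:ℝ) ≤ p + 1)]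
  gcongr
  rw [← Real.norm_eq_abs]
  have hsub : uIcc s t ⊆ uIcc a b := by
    rw [uIcc_of_le hab]; exact ordConnected_Icc.uIcc_subset hs ht
  refine intervalIntegral.norm_integral_le_of_norm_le hst (Eventually.of_forall fun r _ => ?_) ?_
  · rw [norm_mul, Real.norm_eq_abs, abs_of_nonneg (hp.pow_nonneg _)]
    exact mul_le_mul_of_nonneg_left (abs_coord_le_norm _ _) (hp.pow_nonneg _)
  · exact ((v.intervalIntegrable hab).norm.continuousOn_mul
      ((h1 0).continuousOn.pow p)).mono_set hsub

/-- A horizontal curve with the end-points of `exampleCurve` that is not longer than it stays in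
the plane `x₁ = 0`. -/
theorem HasControl.coord_zero_eq_zero (hp : Even p) (hp0 : p ≠ 0) (hab : a ≤ b)
    (hlen : b - a < 2 / ((p : ℝ) + 1)) {η : ℝ → EuclideanSpace ℝ (Fin 3)} {v : Control 2 a b}
    (h : HasControl (exampleFrame p) η v) (ha : η a = exampleCurve a) (hb : η b = exampleCurve b)
    (hv : ‖v‖ ≤ b - a) : ∀ t ∈ Icc a b, η t 0 = 0 := by
  have hma := left_mem_Icc.2 hab
  have hmb := right_mem_Icc.2 hab
  obtain ⟨hac, -⟩ := hasControl_example_iff.1 h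
  have hX : ContinuousOn (fun t => η t 0) (uIcc a b) := (hac 0).continuousOn
  obtain ⟨τ, hτ, hmax⟩ := isCompact_Icc.exists_isMaxOn ⟨a, hma⟩
    (f := fun t => |η t 0|) (by rw [uIcc_of_le hab] at hX; exact hX.abs)
  set M := |η τ 0| with hM
  have hle : ∀ t ∈ Icc a b, |η t 0| ≤ M := fun t ht => hmax ht
  have iv := (v.intervalIntegrable hab).norm
  have iv1 := v.intervalIntegrable_coord hab 1
  have iw : IntervalIntegrable (fun r => η r 0 ^ p * ‖v r‖) volume a b :=
    iv.continuousOn_mul (hX.pow p)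
  have iw1 : IntervalIntegrable (fun r => η r 0 ^ p * v r 1) volume a b :=
    iv1.continuousOn_mul (hX.pow p)
  have ix1 : IntervalIntegrable (fun r => η r 0 * v r 1) volume a b := iv1.continuousOn_mul hX
  have hsplit : ∀ c ∈ Icc a b, (∫ r in a..c, η r 0 ^ p * ‖v r‖) + (∫ r in c..b, η r 0 ^ p * ‖v r‖)
      = ∫ r in a..b, η r 0 ^ p * ‖v r‖ := fun c hc =>
    intervalIntegral.integral_add_adjacent_intervals
      (iw.mono_set (uIcc_subset_uIcc_left (by rwa [uIcc_of_le hab])))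
      (iw.mono_set (uIcc_subset_uIcc_right (by rwa [uIcc_of_le hab])))
  have e1 := h.pow_succ_le_integral hp hab hma hτ hτ.1
  have e2 := h.pow_succ_le_integral hp hab hτ hmb hτ.2
  have ha0 : η a 0 = 0 := by rw [ha]; simp [exampleCurve]
  have hb0 : η b 0 = 0 := by rw [hb]; simp [exampleCurve]
  rw [ha0, zero_pow (Nat.succ_ne_zero p), sub_zero, abs_pow, ← hM] at e1
  rw [hb0, zero_pow (Nat.succ_ne_zero p), zero_sub, abs_neg, abs_pow, ← hM] at e2
  -- The curve leaves `x₁ = 0`, reaches height `M` at time `τ`, and returns: each leg costs `M ^ (p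
  -- + 1)`.
  have e3 : 2 * M ^ (p + 1) ≤ (p + 1) * ∫ r in a..b, η r 0 ^ p * ‖v r‖ := by
    rw [← hsplit τ hτ]; linarith
  have e4 : ∫ r in a..b, η r 0 ^ p * v r 1 = 0 := by
    rw [← h.sub_two_eq hab hma hmb, ha, hb]; simp [exampleCurve]
  have e5 : ∫ r in a..b, (1 - η r 0) * v r 1 = b - a := by
    rw [← h.sub_one_eq hab hma hmb, ha, hb]; simp [exampleCurve]
  -- Subtracting the vanishing integral `e4` replaces `‖v‖` by the excess `‖v‖ - v₂ ≥ 0`; evenness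
  -- of `p` is what bounds the weight by `M ^ p`.
  have e6 : (∫ r in a..b, η r 0 ^ p * ‖v r‖) ≤ M ^ p * ∫ r in a..b, (‖v r‖ - v r 1) := by
    rw [← intervalIntegral.integral_const_mul, ← sub_zero (∫ r in a..b, η r 0 ^ p * ‖v r‖), ← e4,
      ← intervalIntegral.integral_sub iw iw1]
    refine intervalIntegral.integral_mono_on hab (iw.sub iw1) ((iv.sub iv1).const_mul _)
      fun r hr => ?_
    rw [← mul_sub]
    have h1 : η r 0 ^ p ≤ M ^ p := by
      rw [← hp.pow_abs]; exact pow_le_pow_left₀ (abs_nonneg _) (hle r hr) p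
    have h2 : 0 ≤ ‖v r‖ - v r 1 := by linarith [le_abs_self (v r 1), abs_coord_le_norm (v r) 1]
    exact mul_le_mul_of_nonneg_right h1 h2
  have e7 : -(M * ‖v‖) ≤ ∫ r in a..b, η r 0 * v r 1 := by
    rw [v.norm_eq_integral hab, ← intervalIntegral.integral_const_mul]
    refine neg_le_of_abs_le ?_
    rw [← Real.norm_eq_abs]
    refine intervalIntegral.norm_integral_le_of_norm_le hab ?_ (iv.const_mul M)
    refine Eventually.of_forall fun r hr => ?_
    rw [norm_mul]
    exact mul_le_mul (hle r (Ioc_subset_Icc_self hr)) (abs_coord_le_norm _ _) (norm_nonneg _)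
      (abs_nonneg _)
  have e8 : ∫ r in a..b, (1 - η r 0) * v r 1 = ‖v‖ - (∫ r in a..b, (‖v r‖ - v r 1)) -
      ∫ r in a..b, η r 0 * v r 1 := by
    rw [v.norm_eq_integral hab, ← intervalIntegral.integral_sub iv (iv.sub iv1),
      ← intervalIntegral.integral_sub (by simpa using iv1) ix1]
    congr 1; ext r; ring
  have hM0 : M = 0 := by
    by_contra hne
    have hMpos : 0 < M := lt_of_le_of_ne (abs_nonneg _) (Ne.symm hne)
    have hp1 : (0 : ℝ) < p + 1 := by positivity
    have e9 : 2 * M ≤ (p + 1) * ∫ r in a..b, (‖v r‖ - v r 1) := by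
      have : M ^ p * (2 * M) ≤ M ^ p * ((p + 1) * ∫ r in a..b, (‖v r‖ - v r 1)) := by
        calc M ^ p * (2 * M) = 2 * M ^ (p + 1) := by ring
          _ ≤ _ := e3
          _ ≤ _ := mul_le_mul_of_nonneg_left e6 hp1.le
          _ = _ := by ring
      exact le_of_mul_le_mul_left this (pow_pos hMpos p)
    have hL : ‖v‖ * (p + 1) < 2 := (lt_div_iff₀ hp1).1 (hv.trans_lt hlen)
    -- Combines `e5`, `e7`, `e8` with `‖v‖ ≤ b - a`.
    have e10 : (∫ r in a..b, (‖v r‖ - v r 1)) ≤ M * ‖v‖ := by linarith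
    have : (p + 1) * (M * ‖v‖) < 2 * M := by
      calc (p + 1) * (M * ‖v‖) = M * (‖v‖ * (p + 1)) := by ring
        _ < M * 2 := mul_lt_mul_of_pos_left hL hMpos
        _ = 2 * M := by ring
    linarith [mul_le_mul_of_nonneg_left e10 hp1.le]
  exact fun t ht => abs_nonpos_iff.1 (hM0 ▸ hle t ht)

/-- A horizontal curve in the plane `x₁ = 0` is at least as long as its displacement. -/
theorem HasControl.length_ge_of_coord_zero (hab : a ≤ b) {η : ℝ → EuclideanSpace ℝ (Fin 3)}
    {v : Control 2 a b} (h : HasControl (exampleFrame p) η v) (h0 : ∀ t ∈ Icc a b, η t 0 = 0)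
    {s t : ℝ} (hs : s ∈ Icc a b) (ht : t ∈ Icc a b) (hst : s ≤ t) :
    η t 1 - η s 1 ≤ ∫ r in s..t, ‖v r‖ := by
  have hsub : Icc s t ⊆ Icc a b := Icc_subset_Icc hs.1 ht.2
  have hsub' : uIcc s t ⊆ uIcc a b := by rwa [uIcc_of_le hab, uIcc_of_le hst]
  rw [h.sub_one_eq hab hs ht]
  have hX := ((hasControl_example_iff.1 h).1 0).continuousOn
  refine intervalIntegral.integral_mono_on hst
    (((v.intervalIntegrable_coord hab 1).continuousOn_mul (by fun_prop)).mono_set hsub')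
    ((v.intervalIntegrable hab).norm.mono_set hsub') fun r hr => ?_
  rw [h0 r (hsub hr)]
  linarith [le_abs_self (v r 1), abs_coord_le_norm (v r) 1]

theorem isLengthMinimizing_exampleCurve (hp : Even p) (hp0 : p ≠ 0) (hab : a ≤ b)
    (hlen : b - a < 2 / ((p : ℝ) + 1)) : IsLengthMinimizing (exampleFrame p) a b exampleCurve := by
  refine ⟨exampleControl a b, hasControl_exampleCurve hp0, fun η v h ha hb => ?_⟩
  rw [norm_exampleControl hab]
  by_contra! hlt
  have := h.length_ge_of_coord_zero hab (h.coord_zero_eq_zero hp hp0 hab hlen ha hb hlt.le)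
    (left_mem_Icc.2 hab) (right_mem_Icc.2 hab) hab
  rw [← v.norm_eq_integral hab, ha, hb] at this
  simp only [exampleCurve, Matrix.cons_val] at this
  linarith

theorem isUniqueLengthMinimizing_exampleCurve (hp : Even p) (hp0 : p ≠ 0) (hab : a ≤ b)
    (hlen : b - a < 2 / ((p : ℝ) + 1)) :
    IsUniqueLengthMinimizing (exampleFrame p) a b exampleCurve := by
  refine ⟨isLengthMinimizing_exampleCurve hp hp0 hab hlen, fun η ⟨v, h, hmin⟩ ha hb => ?_⟩
  have hma := left_mem_Icc.2 hab
  have hmb := right_mem_Icc.2 hab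
  have hv : ‖v‖ ≤ b - a := by
    rw [← norm_exampleControl hab]
    exact hmin _ _ (hasControl_exampleCurve hp0) ha.symm hb.symm
  have h0 := h.coord_zero_eq_zero hp hp0 hab hlen ha hb hv
  have ha1 : η a 1 = a := by rw [ha]; simp [exampleCurve]
  have hb1 : η b 1 = b := by rw [hb]; simp [exampleCurve]
  have hnn : ∀ ⦃s t⦄, s ∈ Icc a b → t ∈ Icc a b → s ≤ t → 0 ≤ ∫ r in s..t, ‖v r‖ :=
    fun s t _ _ hst => intervalIntegral.integral_nonneg hst fun _ _ => norm_nonneg _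
  have iv := (v.intervalIntegrable hab).norm
  -- The change of parameter is the second coordinate itself. Backtracking on `[s, t]` would force
  -- the pieces on `[a, s]` and `[t, b]` to have total length above `b - a`.
  refine ⟨fun t => η t 1, ?_, fun s hs t ht hst => ?_, ha1, hb1, fun t ht => ?_⟩
  · have := ((hasControl_example_iff.1 h).1 1).continuousOn
    rwa [uIcc_of_le hab] at this
  · have g1 := h.length_ge_of_coord_zero hab h0 hma hs hs.1
    have g2 := h.length_ge_of_coord_zero hab h0 ht hmb ht.2
    have g3 := hnn hs ht hst
    have int : ∀ {c d}, c ∈ Icc a b → d ∈ Icc a b →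
        IntervalIntegrable (fun r => ‖v r‖) volume c d := fun hc hd =>
      iv.mono_set (by rw [uIcc_of_le hab]; exact ordConnected_Icc.uIcc_subset hc hd)
    have g4 := intervalIntegral.integral_add_adjacent_intervals (int hma hs) (int hs ht)
    have g5 := intervalIntegral.integral_add_adjacent_intervals (int hma ht) (int ht hmb)
    rw [← v.norm_eq_integral hab] at g5
    show η s 1 ≤ η t 1
    linarith
  · have e2 := h.sub_two_eq hab hma ht
    have hz : ∫ r in a..t, η r 0 ^ p * v r 1 = 0 := by
      rw [intervalIntegral.integral_congr (g := fun _ => (0 : ℝ)) fun r hr => ?_]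
      · simp
      · rw [uIcc_of_le ht.1] at hr
        simp [h0 r ⟨hr.1, hr.2.trans ht.2⟩, hp0]
    have ha2 : η a 2 = 0 := by rw [ha]; simp [exampleCurve]
    rw [hz, ha2, sub_zero] at e2
    ext i
    fin_cases i
    · simpa [exampleCurve] using h0 t ht
    · simp [exampleCurve]
    · simpa [exampleCurve] using e2

theorem isLocallyLengthMinimizing_exampleCurve (hp : Even p) (hp0 : p ≠ 0) :
    IsLocallyLengthMinimizing (exampleFrame p) univ exampleCurve := by
  refine fun t _ => ⟨1 / ((p : ℝ) + 1), by positivity, fun a _ b _ hab ha hb =>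
    isLengthMinimizing_exampleCurve hp hp0 hab.le ?_⟩
  have : (2 : ℝ) / (p + 1) = 1 / (p + 1) + 1 / (p + 1) := by ring
  linarith [(abs_lt.1 ha).1, (abs_lt.1 hb).2]

/-! ### Trajectories with a prescribed first coordinate -/

theorem HasControl.endpointMap_eq (hab : a ≤ b) {γ : ℝ → EuclideanSpace ℝ (Fin 3)}
    {u : Control 2 a b} (h : HasControl (exampleFrame p) γ u) :
    endpointMap (exampleFrame p) a b (γ a) u = γ b := by
  have hx : ∀ t ∈ Icc a b, γ a 0 + ∫ s in a..t, u s 0 = γ t 0 := fun t ht => by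
    rw [← h.sub_zero_eq hab (left_mem_Icc.2 hab) ht]; ring
  rw [endpointMap_exampleFrame hab _ _ hx, ← h.endpoint_eq hab hx]

theorem norm_contControl_le {k : ℕ} (hab : a ≤ b) {g : ℝ → EuclideanSpace ℝ (Fin k)}
    (hg : Continuous g) {C : ℝ} (hC : ∀ t ∈ Icc a b, ‖g t‖ ≤ C) :
    ‖contControl a b g hg‖ ≤ C * (b - a) := by
  have := intervalIntegral.norm_integral_le_of_norm_le_const (a := a) (b := b) (C := C)
    (f := fun t => ‖g t‖) fun t ht => by
      rw [norm_norm]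
      rw [uIoc_of_le hab] at ht
      exact hC t (Ioc_subset_Icc_self ht)
  rw [abs_of_nonneg (sub_nonneg.2 hab)] at this
  rw [norm_contControl hab]
  exact (le_abs_self _).trans this

theorem norm_vec_two_le (x y : ℝ) : ‖(!₂[x, y] : EuclideanSpace ℝ (Fin 2))‖ ≤ |x| + |y| := by
  rw [EuclideanSpace.norm_eq]
  refine Real.sqrt_le_iff.2 ⟨by positivity, ?_⟩
  simp only [Fin.sum_univ_two, Real.norm_eq_abs, Matrix.cons_val_zero, Matrix.cons_val_one]
  nlinarith [mul_nonneg (abs_nonneg x) (abs_nonneg y)]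

/-- This makes the cost of a small transverse component quadratic, to be beaten by a linear gain. -/
theorem norm_vec_two_le_of_pos (x : ℝ) {y : ℝ} (hy : 0 < y) :
    ‖(!₂[x, y] : EuclideanSpace ℝ (Fin 2))‖ ≤ y + x ^ 2 / (2 * y) := by
  rw [EuclideanSpace.norm_eq]
  refine Real.sqrt_le_iff.2 ⟨by positivity, ?_⟩
  simp only [Fin.sum_univ_two, Real.norm_eq_abs, Matrix.cons_val_zero, Matrix.cons_val_one, sq_abs]
  have h1 : (y + x ^ 2 / (2 * y)) ^ 2 = y ^ 2 + x ^ 2 + (x ^ 2 / (2 * y)) ^ 2 := by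
    field_simp; ring
  rw [h1]
  nlinarith [sq_nonneg (x ^ 2 / (2 * y))]

theorem integral_sum_mul_pow (n : ℕ) (c : ℕ → ℝ) :
    ∫ s in (0 : ℝ)..1, ∑ i ∈ Finset.range n, c i * s ^ i =
      ∑ i ∈ Finset.range n, c i / (i + 1) := by
  rw [intervalIntegral.integral_finsetSum fun i _ =>
    Continuous.intervalIntegrable (by fun_prop) _ _]
  refine Finset.sum_congr rfl fun i _ => ?_
  rw [intervalIntegral.integral_const_mul, integral_pow]
  simp [div_eq_mul_inv]

/-- The control whose trajectory has the first coordinate `W ((t - a) / (b - a))`, with the constant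
second component `κ`. -/
def profileControl (a b : ℝ) (W' : ℝ → ℝ) (hW' : Continuous W') (κ : ℝ) : Control 2 a b :=
  contControl a b (fun t => !₂[W' (t / (b - a) - a / (b - a)) / (b - a), κ]) (by fun_prop)

theorem div_sub_div_mem (hab : a < b) {t : ℝ} (ht : t ∈ Icc a b) :
    t / (b - a) - a / (b - a) ∈ Icc (0 : ℝ) 1 := by
  have hT := sub_pos.2 hab
  rw [← sub_div]
  exact ⟨div_nonneg (sub_nonneg.2 ht.1) hT.le, (div_le_one hT).2 (by linarith [ht.2])⟩

/-- Rescaling time to `[0, 1]` and factoring out `κ` reduces the end-point to `W 1` and the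
integrals of `W` and `Wᵖ`. -/
theorem endpointMap_profileControl (hab : a < b) {W W' : ℝ → ℝ}
    (hW : ∀ s, HasDerivAt W (W' s) s) (hW' : Continuous W') (h0 : W 0 = 0) (κ : ℝ) :
    endpointMap (exampleFrame p) a b (exampleCurve a) (profileControl a b W' hW' κ) =
      !₂[W 1, a + (b - a) * κ * (1 - ∫ s in (0 : ℝ)..1, W s),
        (b - a) * κ * ∫ s in (0 : ℝ)..1, W s ^ p] := by
  have hT := sub_pos.2 hab
  have hma := left_mem_Icc.2 hab.le
  have hmb := right_mem_Icc.2 hab.le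
  have hWc : Continuous W := continuous_iff_continuousAt.2 fun s => (hW s).continuousAt
  have hs1 : b / (b - a) - a / (b - a) = 1 := by rw [← sub_div, div_self hT.ne']
  have hsub : ∀ f : ℝ → ℝ, ∫ t in a..b, f (t / (b - a) - a / (b - a)) =
      (b - a) * ∫ s in (0 : ℝ)..1, f s := fun f => by
    rw [intervalIntegral.integral_comp_div_sub f hT.ne', hs1, sub_self, smul_eq_mul]
  have hae := contControl_ae (a := a) (b := b)
    (fun t => (!₂[W' (t / (b - a) - a / (b - a)) / (b - a), κ] : EuclideanSpace ℝ (Fin 2)))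
    (by fun_prop)
  rw [endpointMap_exampleFrame hab.le _ _ (x := fun t => W (t / (b - a) - a / (b - a)))
    fun t ht => ?_]
  · have hp1 : ∀ᵐ t ∂(volume.restrict (Icc a b)), profileControl a b W' hW' κ t 1 = κ :=
      hae.mono fun t ht => by rw [profileControl, ht]; simp
    rw [integral_congr_of_ae_restrict
        (f := fun t => (1 - W (t / (b - a) - a / (b - a))) *
          profileControl a b W' hW' κ t 1)
        (g := fun t => κ * (1 - W (t / (b - a) - a / (b - a))))
        (hp1.mono fun t ht => by rw [ht, mul_comm]) hma hmb,
      integral_congr_of_ae_restrict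
        (f := fun t => W (t / (b - a) - a / (b - a)) ^ p * profileControl a b W' hW' κ t 1)
        (g := fun t => κ * (W (t / (b - a) - a / (b - a))) ^ p)
        (hp1.mono fun t ht => by rw [ht, mul_comm]) hma hmb,
      hsub (fun s => κ * (1 - W s)), hsub (fun s => κ * W s ^ p),
      intervalIntegral.integral_const_mul, intervalIntegral.integral_const_mul,
      intervalIntegral.integral_sub intervalIntegrable_const (hWc.intervalIntegrable _ _)]
    ext i
    fin_cases i <;> simp [exampleCurve, hs1, mul_assoc]
  · rw [integral_congr_of_ae_restrict (g := fun t => W' (t / (b - a) - a / (b - a)) / (b - a))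
        (hae.mono fun t ht => by rw [profileControl, ht]; simp) hma ht,
      intervalIntegral.integral_eq_sub_of_hasDerivAt
        (f := fun t => W (t / (b - a) - a / (b - a))) (fun s _ => ?_)
        (Continuous.intervalIntegrable (by fun_prop) _ _)]
    · simp [exampleCurve, h0]
    · have := (hW (s / (b - a) - a / (b - a))).comp s
        (((hasDerivAt_id' s).div_const (b - a)).sub_const (a / (b - a)))
      exact this.congr_deriv (by ring)

/-! ### The case `p = 3` -/

theorem integral_cubic_profile (y c : ℝ) :
    ∫ s in (0 : ℝ)..1, ((y + c) * s - c * s ^ 2) ^ 3 =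
      (y + c) ^ 3 / 4 - 3 * (y + c) ^ 2 * c / 5 + (y + c) * c ^ 2 / 2 - c ^ 3 / 7 := by
  have h := integral_sum_mul_pow 7 fun i =>
    [0, 0, 0, (y + c) ^ 3, -3 * (y + c) ^ 2 * c, 3 * (y + c) * c ^ 2, -c ^ 3].getD i 0
  rw [intervalIntegral.integral_congr
    (g := fun s => ((y + c) * s - c * s ^ 2) ^ 3) fun s _ => ?_] at h
  · rw [h]
    simp [Finset.sum_range_succ]
    ring
  · simp [Finset.sum_range_succ]
    ring

theorem integral_linear_profile (y c : ℝ) :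
    ∫ s in (0 : ℝ)..1, ((y + c) * s - c * s ^ 2) = y / 2 + c / 6 := by
  have h := integral_sum_mul_pow 3 fun i => [0, y + c, -c].getD i 0
  rw [intervalIntegral.integral_congr (g := fun s => (y + c) * s - c * s ^ 2) fun s _ => ?_] at h
  · rw [h]
    simp [Finset.sum_range_succ]
    ring
  · simp [Finset.sum_range_succ]
    ring

/-- Given a target `z` near `γ(b)`, take the profile `z₁ s + c s(1 - s)`, which ends at the right
`x₁`; let `κ` match `x₂`, and choose `c` to match `x₃`. -/
theorem isOpenAt_endpointMap_exampleControl (hab : a < b) :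
    IsOpenAt (endpointMap (exampleFrame 3) a b (exampleCurve a)) (exampleControl a b) := by
  intro U hU
  rw [(hasControl_exampleCurve three_ne_zero).endpointMap_eq hab.le]
  obtain ⟨ε, hε, hball⟩ := Metric.mem_nhds_iff.1 hU
  have hT := sub_pos.2 hab
  set T := b - a with hTdef
  -- `(4T + 2) δ` will bound the `L¹` distance to `(0, 1)`, and `δ ≤ 1/2` keeps the divisor `1 - A`
  -- at least `1/2`.
  obtain ⟨δ, hδ, hδ1, hδε⟩ : ∃ δ : ℝ, 0 < δ ∧ δ ≤ 1 / 2 ∧ (4 * T + 2) * δ < ε := by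
    refine ⟨min (1 / 2) (ε / (4 * T + 3)), by positivity, min_le_left _ _, ?_⟩
    have h1 : min (1 / 2) (ε / (4 * T + 3)) ≤ ε / (4 * T + 3) := min_le_right _ _
    calc (4 * T + 2) * min (1 / 2) (ε / (4 * T + 3))
        ≤ (4 * T + 2) * (ε / (4 * T + 3)) := by gcongr
      _ < ε := by
        rw [mul_div_assoc', div_lt_iff₀ (by positivity)]
        nlinarith
  -- `H z c` is the third coordinate reached once `κ` has been fixed by the second. At `z = γ(b)` it
  -- has the sign of `c³`, and the strict signs at `c = ±δ` persist for nearby `z`.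
  let H : EuclideanSpace ℝ (Fin 3) → ℝ → ℝ := fun z c =>
    (z 1 - a) / (1 - (z 0 / 2 + c / 6)) *
      ((z 0 + c) ^ 3 / 4 - 3 * (z 0 + c) ^ 2 * c / 5 + (z 0 + c) * c ^ 2 / 2 - c ^ 3 / 7)
  have hq0 : exampleCurve b 0 = 0 := by simp [exampleCurve]
  have hq1 : exampleCurve b 1 = b := by simp [exampleCurve]
  have hq2 : exampleCurve b 2 = 0 := by simp [exampleCurve]
  have hHq : ∀ c, H (exampleCurve b) c = T / (1 - c / 6) * (c ^ 3 / 140) := fun c => by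
    simp only [H, hq0, hq1]; ring
  have hHc : ∀ c, |c| ≤ 1 / 2 → ContinuousAt (fun z => H z c) (exampleCurve b) := fun c hc => by
    have : 1 - (exampleCurve b 0 / 2 + c / 6) ≠ 0 := by
      rw [hq0]; intro h; linarith [(abs_le.1 hc).2]
    simp only [H]
    refine ContinuousAt.mul (ContinuousAt.div (by fun_prop) (by fun_prop) this) (by fun_prop)
  have hδa : |δ| ≤ 1 / 2 := by rwa [abs_of_pos hδ]
  have hc2 : ContinuousAt (fun z : EuclideanSpace ℝ (Fin 3) => z 2) (exampleCurve b) := by fun_prop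
  have E1 : ∀ᶠ z in 𝓝 (exampleCurve b), z 2 < H z δ := by
    refine hc2.eventually_lt (hHc δ hδa) ?_
    rw [hq2, hHq]
    have : 0 < 1 - δ / 6 := by linarith
    positivity
  have E2 : ∀ᶠ z in 𝓝 (exampleCurve b), H z (-δ) < z 2 := by
    refine (hHc (-δ) (by rwa [abs_neg])).eventually_lt hc2 ?_
    rw [hq2, hHq]
    have : 0 < 1 - -δ / 6 := by linarith
    have : 0 < T / (1 - -δ / 6) * (δ ^ 3 / 140) := by positivity
    have h3 : (-δ) ^ 3 = -δ ^ 3 := by ring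
    rw [h3, neg_div (140 : ℝ), mul_neg]
    linarith
  have E3 : ∀ᶠ z in 𝓝 (exampleCurve b), |z 0| < δ := by
    refine ContinuousAt.eventually_lt (by fun_prop) continuousAt_const ?_
    rw [hq0]; simpa
  have E4 : ∀ᶠ z in 𝓝 (exampleCurve b), |z 1 - b| < δ * T := by
    refine ContinuousAt.eventually_lt (by fun_prop) continuousAt_const ?_
    rw [hq1]; simp; positivity
  filter_upwards [E1, E2, E3, E4] with z h1 h2 h3 h4
  have hA : ∀ c ∈ Icc (-δ) δ, |z 0 / 2 + c / 6| ≤ δ := fun c hc => by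
    rw [abs_lt] at h3
    rw [abs_le]
    constructor <;> linarith [hc.1, hc.2]
  have hAne : ∀ c ∈ Icc (-δ) δ, 1 / 2 ≤ 1 - (z 0 / 2 + c / 6) := fun c hc => by
    linarith [(abs_le.1 (hA c hc)).2]
  obtain ⟨c, hc, hcz⟩ := intermediate_value_Icc (f := H z) (by linarith : -δ ≤ δ)
    (by
      refine ContinuousOn.mul (ContinuousOn.div (by fun_prop) (by fun_prop) fun c hc => ?_)
        (by fun_prop)
      linarith [hAne c hc])
    ⟨h2.le, h1.le⟩
  have hApos := hAne c hc
  have hA' := abs_le.1 (hA c hc)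
  set A := z 0 / 2 + c / 6 with hAdef
  -- Solves `T κ (1 - A) = z 1 - a`, where `A` is the mean of the profile.
  let κ := (z 1 - a) / T / (1 - A)
  have hW : ∀ s, HasDerivAt (fun s => (z 0 + c) * s - c * s ^ 2) ((z 0 + c) - 2 * c * s) s :=
    fun s => (((hasDerivAt_id' s).const_mul (z 0 + c)).fun_sub
      (((hasDerivAt_id' s).fun_pow 2).const_mul c)).congr_deriv (by simp; ring)
  have hW' : Continuous fun s => (z 0 + c) - 2 * c * s := by fun_prop
  refine ⟨profileControl a b _ hW' κ, hball ?_, ?_⟩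
  · rw [Metric.mem_ball, dist_eq_norm, profileControl, exampleControl, contControl_sub]
    refine (norm_contControl_le hab.le (C := 2 * δ / T + 4 * δ) _ fun t ht => ?_).trans_lt ?_
    · have hs := div_sub_div_mem hab ht
      rw [← hTdef] at hs ⊢
      set s := t / T - a / T
      have hvec : (((fun t => !₂[((z 0 + c) - 2 * c * (t / T - a / T)) / T, κ]) -
          fun _ => !₂[0, 1] : ℝ → EuclideanSpace ℝ (Fin 2)) t) =
          !₂[((z 0 + c) - 2 * c * s) / T, κ - 1] := by
        ext i; fin_cases i <;> simp [s]
      rw [hvec]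
      refine (norm_vec_two_le _ _).trans (add_le_add ?_ ?_)
      · rw [abs_div, abs_of_pos hT]
        gcongr
        have e1 : |1 - 2 * s| ≤ 1 := abs_le.2 ⟨by linarith [hs.2], by linarith [hs.1]⟩
        calc |z 0 + c - 2 * c * s| = |z 0 + c * (1 - 2 * s)| := by ring_nf
          _ ≤ |z 0| + |c * (1 - 2 * s)| := abs_add_le _ _
          _ ≤ δ + δ * 1 := by
            rw [abs_mul]
            exact add_le_add h3.le (mul_le_mul (abs_le.2 hc) e1 (abs_nonneg _) hδ.le)
          _ = 2 * δ := by ring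
      · have e1 : |(z 1 - a) / T - 1| ≤ δ := by
          have : (z 1 - a) / T - 1 = (z 1 - b) / T := by
            rw [hTdef] at hT ⊢; field_simp; ring
          rw [this, abs_div, abs_of_pos hT, div_le_iff₀ hT]
          exact h4.le
        have hne : (0 : ℝ) < 1 - A := by linarith
        have : κ - 1 = ((z 1 - a) / T - 1 + A) / (1 - A) := by
          simp only [κ]; field_simp; ring
        rw [this, abs_div, abs_of_pos hne, div_le_iff₀ hne]
        refine (abs_add_le _ _).trans ?_
        have := hA c hc
        nlinarith
    · rw [← hTdef]
      calc (2 * δ / T + 4 * δ) * T = (4 * T + 2) * δ := by field_simp; ring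
        _ < ε := hδε
  · rw [endpointMap_profileControl hab hW hW' (by simp) κ, integral_linear_profile,
      integral_cubic_profile, ← hTdef]
    have hne : 1 - A ≠ 0 := by linarith
    have hTκ : T * κ = (z 1 - a) / (1 - A) := by simp only [κ]; field_simp
    ext i
    fin_cases i
    · simp
    · simp only [Fin.mk_one, Fin.isValue, Matrix.cons_val_one, Matrix.cons_val_zero]
      rw [hTκ, ← hAdef, div_mul_cancel₀ _ hne]; ring
    · simp only [Fin.reduceFinMk, Fin.isValue, Matrix.cons_val]
      rw [hTκ]
      exact hcz

/-! ### Shorter competitors when `p = 3` -/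

theorem integral_bump (ε c : ℝ) :
    ∫ s in (0 : ℝ)..1, ε * (-(s - s ^ 2) + c * (s - s ^ 2) ^ 2) = ε * (-(1 / 6) + c / 30) := by
  rw [intervalIntegral.integral_const_mul]
  have h := integral_sum_mul_pow 5 fun i => [0, -1, 1 + c, -2 * c, c].getD i 0
  rw [intervalIntegral.integral_congr
    (g := fun s => -(s - s ^ 2) + c * (s - s ^ 2) ^ 2) fun s _ => ?_] at h
  · rw [h]
    congr 1
    simp [Finset.sum_range_succ]
    ring
  · simp [Finset.sum_range_succ]
    ring

theorem integral_bump_cube (ε c : ℝ) :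
    ∫ s in (0 : ℝ)..1, (ε * (-(s - s ^ 2) + c * (s - s ^ 2) ^ 2)) ^ 3 =
      ε ^ 3 * (-(1 / 140) + c / 210 - c ^ 2 / 924 + c ^ 3 / 12012) := by
  simp only [mul_pow ε]
  rw [intervalIntegral.integral_const_mul]
  -- The list holds the coefficients of the expanded cube, by increasing degree in `s`.
  have h := integral_sum_mul_pow 13 fun i =>
    [0, 0, 0, -1, 3 + 3 * c, -3 - 12 * c - 3 * c ^ 2, 1 + 18 * c + 15 * c ^ 2 + c ^ 3,
      -12 * c - 30 * c ^ 2 - 6 * c ^ 3, 3 * c + 30 * c ^ 2 + 15 * c ^ 3,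
      -15 * c ^ 2 - 20 * c ^ 3, 3 * c ^ 2 + 15 * c ^ 3, -6 * c ^ 3, c ^ 3].getD i 0
  rw [intervalIntegral.integral_congr
    (g := fun s => (-(s - s ^ 2) + c * (s - s ^ 2) ^ 2) ^ 3) fun s _ => ?_] at h
  · rw [h]
    congr 1
    simp [Finset.sum_range_succ]
    ring
  · simp [Finset.sum_range_succ]
    ring

theorem not_isLengthMinimizing_exampleCurve (hab : a < b) :
    ¬ IsLengthMinimizing (exampleFrame 3) a b exampleCurve := by
  rintro ⟨u, hu, hmin⟩
  have hT := sub_pos.2 hab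
  -- Minimality only provides some control `u` of `γ`; its length is bounded below by the
  -- displacement.
  have hlen' : b - a ≤ ‖u‖ := by
    have h1 := hu.sub_one_eq hab.le (left_mem_Icc.2 hab.le) (right_mem_Icc.2 hab.le)
    have h2 : ∫ x in a..b, (1 - exampleCurve x 0) * u x 1 = ∫ x in a..b, u x 1 := by
      simp [exampleCurve]
    rw [h2] at h1
    simp only [exampleCurve, Matrix.cons_val] at h1
    rw [h1, u.norm_eq_integral hab.le]
    exact intervalIntegral.integral_mono_on hab.le (u.intervalIntegrable_coord hab.le 1)
      (u.intervalIntegrable hab.le).norm fun t _ =>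
        (le_abs_self _).trans (PiLp.norm_apply_le (u t) 1)
  set T := b - a with hTdef
  -- A root `c` makes `∫ w³ = 0` for `w = -(s - s²) + c (s - s²)²`. The mean of `w` is `-m = -1/6 +
  -- c/30`, negative exactly when `c < 5`, so the root must avoid the right end of the interval.
  obtain ⟨c, hc, hc0⟩ : ∃ c ∈ Icc (4 : ℝ) 5,
      -(1 / 140) + c / 210 - c ^ 2 / 924 + c ^ 3 / 12012 = 0 :=
    intermediate_value_Icc (f := fun c : ℝ => -(1 / 140) + c / 210 - c ^ 2 / 924 + c ^ 3 / 12012)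
      (by norm_num) (by fun_prop) ⟨by norm_num, by norm_num⟩
  have hc5 : c < 5 := lt_of_le_of_ne hc.2 fun h => by rw [h] at hc0; norm_num at hc0
  obtain ⟨m, hm, hmdef⟩ : ∃ m : ℝ, 0 < m ∧ m = 1 / 6 - c / 30 := ⟨_, by linarith, rfl⟩
  -- The first bound gives `κ ≥ 1/2`; the second puts the quadratic cost of the bump below the gain
  -- `1 - κ = m ε κ`. The number `11` is a crude bound for `|w'|` when `c ≤ 5`.
  obtain ⟨ε, hε, hεm, hεT⟩ : ∃ ε : ℝ, 0 < ε ∧ m * ε ≤ 1 ∧ ε * (11 / T) ^ 2 * 2 < m := by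
    refine ⟨min (1 / m) (m / ((11 / T) ^ 2 * 4)), by positivity, ?_, ?_⟩
    · calc m * min (1 / m) (m / ((11 / T) ^ 2 * 4)) ≤ m * (1 / m) := by gcongr; exact min_le_left _ _
        _ = 1 := by field_simp
    · calc min (1 / m) (m / ((11 / T) ^ 2 * 4)) * (11 / T) ^ 2 * 2
          ≤ m / ((11 / T) ^ 2 * 4) * (11 / T) ^ 2 * 2 := by gcongr; exact min_le_right _ _
        _ = m / 2 := by field_simp; norm_num
        _ < m := by linarith
  have h1m : 0 < 1 + m * ε := by positivity
  -- The negative mean of `x₁` speeds up `x₂` by the factor `1 + m ε`, so this smaller speed still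
  -- reaches `b`.
  let κ := 1 / (1 + m * ε)
  have hκ : 0 < κ := by positivity
  have hκm : κ * (1 + m * ε) = 1 := by simp only [κ]; field_simp
  have hW : ∀ s, HasDerivAt (fun s => ε * (-(s - s ^ 2) + c * (s - s ^ 2) ^ 2))
      (ε * ((1 - 2 * s) * (-1 + 2 * c * (s - s ^ 2)))) s := fun s => by
    have hw := (hasDerivAt_id' s).fun_sub ((hasDerivAt_id' s).fun_pow 2)
    exact ((hw.fun_neg.fun_add ((hw.fun_pow 2).const_mul c)).const_mul ε).congr_deriv
      (by norm_num only [Nat.cast_ofNat]; ring)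
  have hW' : Continuous fun s => ε * ((1 - 2 * s) * (-1 + 2 * c * (s - s ^ 2))) := by fun_prop
  set v := profileControl a b _ hW' κ with hv
  have hend : endpointMap (exampleFrame 3) a b (exampleCurve a) v = exampleCurve b := by
    rw [endpointMap_profileControl hab hW hW' (by simp) κ, integral_bump, integral_bump_cube, hc0]
    ext i
    fin_cases i
    · simp [exampleCurve]
    · simp only [exampleCurve, Fin.mk_one, Fin.isValue, Matrix.cons_val_one, Matrix.cons_val_zero]
      have : 1 - ε * (-(1 / 6) + c / 30) = 1 + m * ε := by rw [hmdef]; ring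
      rw [this, mul_assoc, hκm]; ring
    · simp [exampleCurve]
  have htraj := hasControl_exampleTraj (p := 3) hab.le (exampleCurve a) v
  have hmv := hmin _ v htraj (exampleTraj_left _ _) (by
    rw [← htraj.endpointMap_eq hab.le, exampleTraj_left, hend])
  have hbound : ‖v‖ ≤ (κ + (ε * (11 / T)) ^ 2 / (2 * κ)) * T := by
    refine norm_contControl_le hab.le _ fun t ht => (norm_vec_two_le_of_pos _ hκ).trans ?_
    have hs := div_sub_div_mem hab ht
    set s := t / (b - a) - a / (b - a)
    have hbd : |ε * ((1 - 2 * s) * (-1 + 2 * c * (s - s ^ 2))) / (b - a)| ≤ ε * (11 / T) := by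
      rw [abs_div, abs_mul, abs_mul, abs_of_pos hε, ← hTdef, abs_of_pos hT, ← mul_div_assoc]
      gcongr
      have e1 : |1 - 2 * s| ≤ 1 := abs_le.2 ⟨by linarith [hs.2], by linarith [hs.1]⟩
      have e2 : 0 ≤ s - s ^ 2 := by nlinarith [hs.1, hs.2]
      have e3 : s - s ^ 2 ≤ 1 := by nlinarith [hs.1, hs.2]
      have e4 : |-1 + 2 * c * (s - s ^ 2)| ≤ 11 := by
        have hcnn : 0 ≤ c := by linarith [hc.1]
        have := mul_nonneg hcnn e2
        have := mul_le_mul hc5.le e3 e2 (by norm_num)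
        exact abs_le.2 ⟨by linarith, by linarith⟩
      calc |1 - 2 * s| * |-1 + 2 * c * (s - s ^ 2)| ≤ 1 * 11 :=
            mul_le_mul e1 e4 (abs_nonneg _) zero_le_one
        _ = 11 := one_mul _
    have := sq_le_sq' (abs_le.1 hbd).1 (abs_le.1 hbd).2
    gcongr
  have hlt : κ + (ε * (11 / T)) ^ 2 / (2 * κ) < 1 := by
    have e1 : (ε * (11 / T)) ^ 2 / (2 * κ) = ε * (ε * (11 / T) ^ 2) * (1 + m * ε) / 2 := by
      simp only [κ]; field_simp
    have e2 : 1 - κ = m * ε * κ := by linarith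
    have hκ2 : 1 / 2 ≤ κ := one_div_le_one_div_of_le h1m (by linarith)
    have e3 : ε * (ε * (11 / T) ^ 2) * (1 + m * ε) / 2 ≤ ε * (ε * (11 / T) ^ 2) := by
      have : 0 ≤ ε * (ε * (11 / T) ^ 2) := by positivity
      nlinarith
    have e4 : ε * (ε * (11 / T) ^ 2) < ε * (m / 2) :=
      mul_lt_mul_of_pos_left (by linarith) hε
    have e5 : m * ε * (1 / 2) ≤ m * ε * κ := mul_le_mul_of_nonneg_left hκ2 (by positivity)
    rw [e1]
    linarith
  have : (κ + (ε * (11 / T)) ^ 2 / (2 * κ)) * T < 1 * T := mul_lt_mul_of_pos_right hlt hT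
  linarith

theorem not_isLocallyLengthMinimizing_exampleCurve (hab : a < b) :
    ¬ IsLocallyLengthMinimizing (exampleFrame 3) (Icc a b) exampleCurve := by
  intro h
  obtain ⟨ε, hε, hmin⟩ := h a (left_mem_Icc.2 hab.le)
  -- Minimality fails on every segment, in particular on a short one starting at `a`.
  have hlt : a < min b (a + ε / 2) := lt_min hab (by linarith)
  refine not_isLengthMinimizing_exampleCurve hlt (hmin a (left_mem_Icc.2 hab.le) _
    ⟨hlt.le, min_le_left _ _⟩ hlt (by simpa) ?_)
  rw [abs_of_pos (sub_pos.2 hlt)]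
  linarith [min_le_right b (a + ε / 2)]

end SubRiem

end

theorem theorem3 (p : ℕ) (hp : 1 ≤ p) :
    -- (i)
    (2 ≤ p → ∀ a b : ℝ, a < b →
      SubRiem.IsStrictlySingularExtremal (SubRiem.exampleFrame p) a b SubRiem.exampleCurve) ∧
    -- (ii)
    (Even p →
      SubRiem.IsLocallyLengthMinimizing (SubRiem.exampleFrame p) Set.univ SubRiem.exampleCurve ∧
      ∀ a b : ℝ, a < b → b - a < 2 / ((p : ℝ) + 1) →
        SubRiem.IsUniqueLengthMinimizing (SubRiem.exampleFrame p) a b SubRiem.exampleCurve) ∧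
    -- (iii)
    (p = 3 → ∀ a b : ℝ, a < b →
      ¬ SubRiem.IsLocallyLengthMinimizing (SubRiem.exampleFrame p) (Set.Icc a b)
          SubRiem.exampleCurve ∧
      ∃ u : SubRiem.Control 2 a b,
        SubRiem.HasControl (SubRiem.exampleFrame p) SubRiem.exampleCurve u ∧
        SubRiem.IsOpenAt
          (SubRiem.endpointMap (SubRiem.exampleFrame p) a b (SubRiem.exampleCurve a)) u) := by
  exact ⟨fun hp2 a b hab => SubRiem.isStrictlySingularExtremal_exampleCurve hp2 hab,
    fun he => ⟨SubRiem.isLocallyLengthMinimizing_exampleCurve he (by omega), fun a b hab hlen =>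
      SubRiem.isUniqueLengthMinimizing_exampleCurve he (by omega) hab.le hlen⟩,
    fun h3 a b hab => by
      subst h3
      exact ⟨SubRiem.not_isLocallyLengthMinimizing_exampleCurve hab, SubRiem.exampleControl a b,
        SubRiem.hasControl_exampleCurve three_ne_zero,
        SubRiem.isOpenAt_endpointMap_exampleControl hab⟩⟩
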